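/- Let $C\ge 2$ (classes), $N$ (examples per class), $P$ (feature dimension). A feature matrix $H\in\mathbb R^{P\times CN}$ has columns $h_{i,c}$ ordered $i$-then-$c$ (all examples of class 1 first, then class 2, and so on). Let $Y\in\mathbb R^{C\times CN}$ be the one-hot label matrix with columns $y_{i,c}$, $\mu_c(H)$ the class means, $\mu_G(H)$ the global mean, $\bar H=H-\mu_G\mathbf 1_{CN}^\top$, $\bar M=[\mu_1-\mu_G,\dots,\mu_C-\mu_G]$, $\Sigma_W=\frac1{CN}\sum_{i,c}(h_{i,c}-\mu_c)(h_{i,c}-\mu_c)^\top$, $\Sigma_B=\frac1C\bar M\bar M^\top$, $\Sigma_T=\frac1{CN}\bar H\bar H^\top$. Put $W_{LS}(H)=C^{-1}\bar M^\top\Sigma_T^{-1}$, $b_{LS}(H)=C^{-1}\mathbf 1_C-W_{LS}\mu_G$ and $\mathcal L_{LS}(H)=\frac1{2CN}\|W_{LS}H+b_{LS}\mathbf 1_{CN}^\top-Y\|_F^2$ (the least-squares classifier and the MSE loss on the central path, without weight decay). Let $\mathcal X=\{X\in\mathbb R^{P\times CN}:\Sigma_W(X)=I_P\}$. Since $\Sigma_W(X)=XKX^\top$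 with $K=\frac1{CN}(I_{CN}-\frac1NY^\top Y)$, its tangent space is $T_X\mathcal X=\{Z: XKZ^\top+ZKX^\top=0\}$. Let $\Pi_{T_X\mathcal X}$ be either the orthogonal projection onto $T_X\mathcal X$ for the Frobenius inner product, or the projection $Z\mapsto Z-\frac12(XKZ^\top+ZKX^\top)X$ onto $T_X\mathcal X$; the result holds for each of the two. Let $H_t$, $t\ge0$, be feature matrices with $\Sigma_{W,t}=\Sigma_W(H_t)$ positive definite for all $t\ge 0$, $\mu_G(H_0)=0$, and suppose that the renormalized features $X_t=\Sigma_{W,t}^{-1/2}H_t$ follow the continually renormalized gradient flow $\frac{d}{dt}X=-\Pi_{T_X\mathcal X}(\nabla_X\mathcal L_{LS}(X))$ for $t\ge0$. Let $\mathrm{SNR}_t=\Sigma_{W,t}^{-1/2}\bar M(H_t)$, let $\omega_{\max}(t)$ be its largest singular value, and suppose $\operatorname{rank}\mathrm{SNR}_0=C-1$. Let $\mathrm{SNR}_0=\widehat U_0\,\mathrm{diag}(\omega_1,\dots,\omega_{C-1})\widehat V_0^\top$ be any singular value decomposition restricted to the nonzero singular values, with $\widehat U_0\in\mathbb R^{P\times(C-1)}$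 and $\widehat V_0\in\mathbb R^{C\times(C-1)}$ having orthonormal columns. Then, as $t\to\infty$, $$\frac1{\omega_{\max}(t)}\mathrm{SNR}_t\to\widehat U_0\widehat V_0^\top,\qquad \frac1{\omega_{\max}(t)}\Sigma_{W,t}^{-1/2}\bar H_t\to(\widehat U_0\widehat V_0^\top)\otimes\mathbf 1_N^\top,$$ the columns of $\widehat U_0\widehat V_0^\top$ form a Simplex ETF, that is, $(\widehat U_0\widehat V_0^\top)^\top\widehat U_0\widehat V_0^\top=\alpha\left(\frac{C}{C-1}I_C-\frac1{C-1}\mathbf 1_C\mathbf 1_C^\top\right)$ for some $\alpha>0$, and Neural Collapse occurs for the renormalized features $X_t$. In (NC1)–(NC4), all means, covariances and $w_c$ (the rows of $W_{LS}$), $b=b_{LS}$ are those of $X_t$: (NC1) $\Sigma_B^\dagger\Sigma_W\to0$, with $\dagger$ the Moore–Penrose pseudoinverse. (NC2) $\frac{\langle\mu_c-\mu_G,\mu_{c'}-\mu_G\rangle}{\|\mu_c-\mu_G\|\,\|\mu_{c'}-\mu_G\|}\to1$ if $c=c'$ and $\to-\frac1{C-1}$ if $c\ne c'$; and $\|\mu_c-\mu_G\|-\|\mu_{c'}-\mu_G\|\to0$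 for $c\neq c'$. (NC3) $\frac{w_c}{\|w_c\|}-\frac{\mu_c-\mu_G}{\|\mu_c-\mu_G\|}\to0$ for every $c$. (NC4) For Lebesgue-almost every $h\in\mathbb R^P$, for all sufficiently large $t$, $\arg\max_{c}(\langle w_{c},h\rangle+b_{c})=\arg\min_{c}\|h-\mu_{c}\|$ as sets of classes. More precisely, if $c$ is the unique maximizer over $c'$ of $\langle\widehat U_0\widehat V_0^\top e_{c'},h\rangle$ ($e_{c'}$ the standard basis vectors of $\mathbb R^C$), then both sets are eventually $\{c\}$. Likewise, when $h$ is the training feature $x_{i,c}(t)$, the column $(i,c)$ of $X_t$, both sets are eventually $\{c\}$. -/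

import Mathlib

open Filter Topology Matrix MeasureTheory
open scoped Kronecker

noncomputable section

namespace NeuralCollapse

/-- Feature matrices: `P` feature dimensions, `C` classes, `N` examples per class. The column
`(c, i)` is the feature vector of the `i`-th example of class `c`. -/
abbrev Features (P C N : ℕ) := Matrix (Fin P) (Fin C × Fin N) ℝ

variable {P C N : ℕ}

/-! ### Means, covariances, labels -/

/-- One-hot labels `Y`, stacked as columns. -/
def labels (C N : ℕ) : Matrix (Fin C) (Fin C × Fin N) ℝ :=
  Matrix.of fun c k => if c = k.1 then 1 else 0

/-- The class mean `μ_c`. -/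
def classMean (H : Features P C N) (c : Fin C) : Fin P → ℝ :=
  fun p => (1 / (N : ℝ)) * ∑ i, H p (c, i)

/-- The global mean `μ_G`. -/
def globalMean (H : Features P C N) : Fin P → ℝ :=
  fun p => (1 / ((C : ℝ) * N)) * ∑ k, H p k

/-- Globally centered features `H - μ_G 1ᵀ`. -/
def centered (H : Features P C N) : Features P C N :=
  Matrix.of fun p k => H p k - globalMean H p

/-- Globally centered class means, `[μ_1 - μ_G, …, μ_C - μ_G]`. -/
def centeredMeans (H : Features P C N) : Matrix (Fin P) (Fin C) ℝ :=
  Matrix.of fun p c => classMean H c p - globalMean H p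

/-- Within-class covariance `Σ_W`. -/
def withinCov (H : Features P C N) : Matrix (Fin P) (Fin P) ℝ :=
  (1 / ((C : ℝ) * N)) • ∑ k : Fin C × Fin N,
    vecMulVec (fun p => H p k - classMean H k.1 p) (fun p => H p k - classMean H k.1 p)

/-- Between-class covariance `Σ_B`. -/
def betweenCov (H : Features P C N) : Matrix (Fin P) (Fin P) ℝ :=
  (1 / (C : ℝ)) • ∑ c : Fin C,
    vecMulVec (fun p => classMean H c p - globalMean H p)
      (fun p => classMean H c p - globalMean H p)

/-- Total covariance `Σ_T`. -/
def totalCov (H : Features P C N) : Matrix (Fin P) (Fin P) ℝ :=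
  (1 / ((C : ℝ) * N)) • (centered H * (centered H)ᵀ)

/-! ### The loss along the central path -/

/-- MSE loss without weight decay, for the classifier `x ↦ W x + b`. -/
def mseLoss (W : Matrix (Fin C) (Fin P) ℝ) (b : Fin C → ℝ) (H : Features P C N) : ℝ :=
  (1 / (2 * ((C : ℝ) * N))) *
    ∑ k : Fin C × Fin N, ∑ c : Fin C, ((W * H) c k + b c - labels C N c k) ^ 2

/-- The least-squares classifier `W_LS = C⁻¹ M̄ᵀ Σ_T⁻¹`. -/
def weightLS (H : Features P C N) : Matrix (Fin C) (Fin P) ℝ :=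
  (1 / (C : ℝ)) • ((centeredMeans H)ᵀ * (totalCov H)⁻¹)

/-- The least-squares bias `b_LS = C⁻¹ 1 - W_LS μ_G`. -/
def biasLS (H : Features P C N) : Fin C → ℝ :=
  fun c => 1 / (C : ℝ) - (weightLS H *ᵥ globalMean H) c

/-- The loss on the central path, where the classifier is the least-squares one. -/
def lossLS (H : Features P C N) : ℝ := mseLoss (weightLS H) (biasLS H) H

/-- The Euclidean gradient of `lossLS`: the matrix of its partial derivatives. -/
def gradLossLS (X : Features P C N) : Features P C N :=
  Matrix.of fun p k => deriv (fun s : ℝ => lossLS (X + s • Matrix.single p k (1 : ℝ))) 0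

/-! ### The manifold of identity-covariance features and its flow -/

/-- Class-centering matrix `(CN)⁻¹ (I - N⁻¹ Yᵀ Y)`; it satisfies `Σ_W(X) = X * centering * Xᵀ`,
see `withinCov_eq`. -/
def centering (C N : ℕ) : Matrix (Fin C × Fin N) (Fin C × Fin N) ℝ :=
  (1 / ((C : ℝ) * N)) • (1 - (1 / (N : ℝ)) • ((labels C N)ᵀ * labels C N))

theorem withinCov_eq (H : Features P C N) : withinCov H = H * centering C N * Hᵀ := by
  have hY : H * (labels C N)ᵀ * labels C N =
      Matrix.of fun p k => (∑ i, H p (k.1, i)) := by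
    ext p ⟨c, j⟩
    simp only [Matrix.mul_apply, labels, Fintype.sum_prod_type, Matrix.of_apply,
      Matrix.transpose_apply]
    rw [Finset.sum_eq_single c]
    · simp
    · intro b _ hb
      simp [hb]
    · simp
  have hc : H * centering C N = (1 / ((C : ℝ) * N)) •
      Matrix.of fun p k => H p k - classMean H k.1 p := by
    rw [centering, Matrix.mul_smul, Matrix.mul_sub, Matrix.mul_one, Matrix.mul_smul,
      ← Matrix.mul_assoc, hY]
    ext p k
    simp [classMean]
  rw [hc, withinCov, Matrix.smul_mul]
  congr 1
  ext p q
  rcases Nat.eq_zero_or_pos N with rfl | hN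
  · simp [Matrix.mul_apply, Matrix.sum_apply]
  have hN' : (N : ℝ) ≠ 0 := by exact_mod_cast hN.ne'
  simp only [Matrix.sum_apply, vecMulVec_apply, Matrix.mul_apply, Matrix.of_apply,
    Matrix.transpose_apply, Fintype.sum_prod_type]
  refine Finset.sum_congr rfl fun c _ => ?_
  have h0 : ∑ i, (H p (c, i) - classMean H c p) = 0 := by
    simp [classMean, Finset.sum_sub_distrib]
    field_simp
    simp
  simp only [mul_sub, Finset.sum_sub_distrib, ← Finset.sum_mul, h0]
  simp

/-- Features whose within-class covariance is the identity. -/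
def manifold (P C N : ℕ) : Set (Features P C N) := {X | withinCov X = 1}

/-- Tangent space of `manifold` at `X`: the kernel of the differential at `X` of
`X ↦ X * centering * Xᵀ`. -/
def tangentSpace (X : Features P C N) : Set (Features P C N) :=
  {Z | X * centering C N * Zᵀ + Z * centering C N * Xᵀ = 0}

/-- `V` is the orthogonal projection (for the Frobenius inner product) of `Z` onto the tangent
space at `X`. -/
def IsOrthogonalProjection (X Z V : Features P C N) : Prop :=
  V ∈ tangentSpace X ∧ ∀ T ∈ tangentSpace X, ((Z - V)ᵀ * T).trace = 0

/-- `V` is the image of `Z` under the projection onto the tangent space at `X` that is the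
linearization at `X` of the renormalization map `H ↦ Σ_W(H)^(-1/2) H`. -/
def IsRenormalizingProjection (X Z V : Features P C N) : Prop :=
  V = Z - (1 / 2 : ℝ) • ((X * centering C N * Zᵀ + Z * centering C N * Xᵀ) * X)

/-- `X` solves `dX/dt = - Π (∇ lossLS (X))` on the manifold for all `t ≥ 0`, where `Π` is the
projection onto the tangent space at `X` given by `proj`
(at `t = 0` the derivative is the one-sided one). -/
def IsProjectedFlow (proj : Features P C N → Features P C N → Features P C N → Prop)
    (X : ℝ → Features P C N) : Prop :=
  ∀ t : ℝ, 0 ≤ t → X t ∈ manifold P C N ∧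
    ∃ V : Features P C N, proj (X t) (gradLossLS (X t)) V ∧
      ∀ p k, HasDerivWithinAt (fun s => X s p k) (-(V p k)) (Set.Ici 0) t

/-- Continually renormalized gradient flow, for either of the two projections. -/
def IsRenormalizedFlow (X : ℝ → Features P C N) : Prop :=
  IsProjectedFlow IsOrthogonalProjection X ∨ IsProjectedFlow IsRenormalizingProjection X

/-! ### Renormalization, the SNR matrix and its singular values -/

/-- `A ^ (-1/2)` for a positive definite matrix `A`, by the functional calculus. -/
def invSqrt (A : Matrix (Fin P) (Fin P) ℝ) : Matrix (Fin P) (Fin P) ℝ :=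
  cfc (fun x : ℝ => (Real.sqrt x)⁻¹) A

/-- Renormalized features `Σ_W ^ (-1/2) H`. -/
def renormalize (H : Features P C N) : Features P C N := invSqrt (withinCov H) * H

/-- The signal-to-noise ratio matrix `Σ_W ^ (-1/2) M̄`. -/
def snr (H : Features P C N) : Matrix (Fin P) (Fin C) ℝ :=
  invSqrt (withinCov H) * centeredMeans H

/-- The largest singular value of a matrix. -/
def maxSingularValue (S : Matrix (Fin P) (Fin C) ℝ) : ℝ :=
  (Matrix.toEuclideanLin S).singularValues 0

/-- `S = U diag(ω) Vᵀ` is a singular value decomposition of `S` restricted to its nonzero singular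
values `ω 0, …, ω (r - 1)`; the columns of `U`, `V` are the corresponding singular vectors. -/
structure IsCompactSVD {r : ℕ} (S : Matrix (Fin P) (Fin C) ℝ) (U : Matrix (Fin P) (Fin r) ℝ)
    (ω : Fin r → ℝ) (V : Matrix (Fin C) (Fin r) ℝ) : Prop where
  left_orthonormal : Uᵀ * U = 1
  right_orthonormal : Vᵀ * V = 1
  pos : ∀ j, 0 < ω j
  eq : S = U * Matrix.diagonal ω * Vᵀ

/-- The row of ones `1_Nᵀ`. -/
def onesRow (N : ℕ) : Matrix Unit (Fin N) ℝ := Matrix.of fun _ _ => 1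

/-- `E ⊗ 1_Nᵀ`, with its rows indexed by `Fin P` instead of `Fin P × Unit`. -/
def kronOnes (N : ℕ) (E : Matrix (Fin P) (Fin C) ℝ) : Features P C N :=
  (E ⊗ₖ onesRow N).submatrix (fun p => (p, ())) id

/-! ### Neural collapse -/

/-- `B` is the Moore–Penrose pseudoinverse of `A`. -/
structure IsMoorePenrose (A B : Matrix (Fin P) (Fin P) ℝ) : Prop where
  mul_mul_left : A * B * A = A
  mul_mul_right : B * A * B = B
  symm_left : (A * B)ᵀ = A * B
  symm_right : (B * A)ᵀ = B * A

open Classical in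
/-- The Moore–Penrose pseudoinverse of a square matrix (it exists and is unique). -/
def pinv (A : Matrix (Fin P) (Fin P) ℝ) : Matrix (Fin P) (Fin P) ℝ :=
  if h : ∃ B, IsMoorePenrose A B then h.choose else 0

/-- The class mean `μ_c` as a Euclidean vector. -/
def meanVec (X : Features P C N) (c : Fin C) : EuclideanSpace ℝ (Fin P) :=
  WithLp.toLp 2 (classMean X c)

/-- The centered class mean `μ_c - μ_G` as a Euclidean vector. -/
def centeredMeanVec (X : Features P C N) (c : Fin C) : EuclideanSpace ℝ (Fin P) :=
  WithLp.toLp 2 fun p => centeredMeans X p c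

/-- The classifier `w_c` on the central path: the `c`-th row of `W_LS`. -/
def weightVec (X : Features P C N) (c : Fin C) : EuclideanSpace ℝ (Fin P) :=
  WithLp.toLp 2 (weightLS X c)

/-- The feature vector of the `i`-th example of class `c`. -/
def featureVec (X : Features P C N) (c : Fin C) (i : Fin N) : EuclideanSpace ℝ (Fin P) :=
  WithLp.toLp 2 fun p => X p (c, i)

/-- The set of maximizers `c` of `⟨w_c, h⟩ + b_c`, for the least-squares classifier of `X`. -/
def classifierDecision (X : Features P C N) (h : EuclideanSpace ℝ (Fin P)) : Set (Fin C) :=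
  {c | ∀ c', inner ℝ (weightVec X c') h + biasLS X c' ≤ inner ℝ (weightVec X c) h + biasLS X c}

/-- The set of minimizers `c` of `‖h - μ_c‖`. -/
def nearestMeanDecision (X : Features P C N) (h : EuclideanSpace ℝ (Fin P)) : Set (Fin C) :=
  {c | ∀ c', ‖h - meanVec X c‖ ≤ ‖h - meanVec X c'‖}

/-- Within-class variability collapse: `Σ_B† Σ_W → 0`. -/
def NC1 (X : ℝ → Features P C N) : Prop :=
  Tendsto (fun t => pinv (betweenCov (X t)) * withinCov (X t)) atTop (𝓝 0)

/-- Convergence of the class means to a simplex equiangular tight frame. -/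
def NC2 (X : ℝ → Features P C N) : Prop :=
  (∀ c c' : Fin C, Tendsto
    (fun t => inner ℝ (centeredMeanVec (X t) c) (centeredMeanVec (X t) c') /
      (‖centeredMeanVec (X t) c‖ * ‖centeredMeanVec (X t) c'‖))
    atTop (𝓝 (if c = c' then 1 else -1 / ((C : ℝ) - 1)))) ∧
  ∀ c c' : Fin C, c ≠ c' → Tendsto
    (fun t => ‖centeredMeanVec (X t) c‖ - ‖centeredMeanVec (X t) c'‖) atTop (𝓝 0)

/-- Convergence to self-duality. -/
def NC3 (X : ℝ → Features P C N) : Prop :=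
  ∀ c : Fin C, Tendsto
    (fun t => ‖weightVec (X t) c‖⁻¹ • weightVec (X t) c -
      ‖centeredMeanVec (X t) c‖⁻¹ • centeredMeanVec (X t) c) atTop (𝓝 0)

/-- Simplification to the nearest class mean: for Lebesgue-almost every activation `h` (those for
which there is no tie in the limit), and also for each of the evolving training activations, the
decisions of the classifier and of the nearest-class-mean rule agree from some time on. In the
latter case the common decision is the correct class. -/
def NC4 (X : ℝ → Features P C N) : Prop :=
  (∀ᵐ h : EuclideanSpace ℝ (Fin P), ∀ᶠ t in atTop,
    classifierDecision (X t) h = nearestMeanDecision (X t) h) ∧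
  ∀ (c : Fin C) (i : Fin N), ∀ᶠ t in atTop,
    classifierDecision (X t) (featureVec (X t) c i) = {c} ∧
    nearestMeanDecision (X t) (featureVec (X t) c i) = {c}

/-- The columns of `E` form a simplex equiangular tight frame. -/
def IsSimplexETF (E : Matrix (Fin P) (Fin C) ℝ) : Prop :=
  ∃ α : ℝ, 0 < α ∧ Eᵀ * E = α • (((C : ℝ) / ((C : ℝ) - 1)) • (1 : Matrix (Fin C) (Fin C) ℝ) -
    (1 / ((C : ℝ) - 1)) • Matrix.of fun _ _ => (1 : ℝ))

end NeuralCollapse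

end

open NeuralCollapse

noncomputable section

namespace NeuralCollapse

variable {P C N : ℕ}

/-! ### The linear maps taking features to centered means and covariances -/

/-! Write `M` for the centered class means of the renormalized features `X`, and `R` for the inverse
of `1 + M Mᵀ / C`, the total covariance on the manifold. Centered means are `X * A` with `A =
averaging C N`, and `centering C N * A = 0`, so class means and within-class deviations decouple. On
the central path the loss is a constant minus `tr (Mᵀ Σ_T⁻¹ M) / (2 C²)` (`lossLS_eq`), and its
gradient on the manifold has two terms (`gradLossLS_eq`): one proportional to `R² M Aᵀ`, which is
tangent, and one coming from the within-class covariance, which is normal for the Frobenius product.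
Each projection therefore leaves an autonomous equation for the means alone, `M' = κ R^k M` with `κ
= 1 / (C² N)`, where `k = 2` for the orthogonal projection and `k = 1` for the renormalizing one
(`flow_means`).

If `M = U diag(ω) Vᵀ`, then `R^k M` has the same singular vectors. Letting each `ω_j` solve `ω' = κ
ω / (1 + ω² / C)^k` gives an explicit solution, which is the flow by uniqueness
(`means_flow_unique`, `means_flow_svd`). Along the scalar equation `log ω + p(ω)` grows at rate `κ`
for a potential `p` that increases at least as fast as `ω² / (2C)`. Hence every `ω_j` tends to
infinity, while the differences `ω_i² - ω_j²` stay bounded. In particular all ratios tend to 1 and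
`M / ω_max → U Vᵀ`.

Since `V` has `C - 1` orthonormal columns, all orthogonal to the ones vector, `V Vᵀ` is the
centering projection, and this is the Gram matrix of `U Vᵀ`: a simplex ETF. Neural collapse is then
read off from these asymptotics (`IsCollapsing`). Convergence of ratios is not enough for equal
norms in NC2 or for the nearest-mean rule at a fixed `h`; these use the bounded differences of
squares (`tendsto_norm_sq_defect`). -/

/-- The orthogonal projection onto the vectors of mean zero. -/
def centeringProj (C : ℕ) : Matrix (Fin C) (Fin C) ℝ :=
  1 - (1 / (C : ℝ)) • Matrix.of fun _ _ => (1 : ℝ)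

/-- The matrix `A` such that `X * A` holds the centered class means of `X`. -/
def averaging (C N : ℕ) : Matrix (Fin C × Fin N) (Fin C) ℝ :=
  Matrix.of fun k c => (1 / (N : ℝ)) * centeringProj C k.1 c

theorem centeringProj_apply (c c' : Fin C) :
    centeringProj C c c' = (if c = c' then 1 else 0) - 1 / (C : ℝ) := by
  simp [centeringProj, Matrix.one_apply]

theorem centeringProj_transpose : (centeringProj C)ᵀ = centeringProj C := by
  ext i j; simp [centeringProj_apply, eq_comm]

theorem sum_centeringProj (hC : C ≠ 0) (c : Fin C) : ∑ c', centeringProj C c c' = 0 := by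
  have : (C : ℝ) ≠ 0 := by exact_mod_cast hC
  simp [centeringProj_apply, this]

theorem sum_centeringProj' (hC : C ≠ 0) (c : Fin C) : ∑ c', centeringProj C c' c = 0 := by
  rw [← sum_centeringProj hC c]
  exact Finset.sum_congr rfl fun i _ => congrFun (congrFun centeringProj_transpose c) i

theorem mul_centeringProj {R : Type*} (M : Matrix R (Fin C) ℝ) (h : ∀ r, ∑ c, M r c = 0) :
    M * centeringProj C = M := by
  rw [centeringProj, Matrix.mul_sub, Matrix.mul_one, sub_eq_self]
  ext r c
  simp [Matrix.mul_apply, h, ← Finset.sum_mul]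

theorem centeringProj_mul_self (hC : C ≠ 0) :
    centeringProj C * centeringProj C = centeringProj C :=
  mul_centeringProj _ (sum_centeringProj hC)

theorem centeredMeans_eq (X : Features P C N) : centeredMeans X = X * averaging C N := by
  ext p c
  simp only [centeredMeans, classMean, globalMean, averaging, Matrix.of_apply, Matrix.mul_apply,
    centeringProj_apply, Fintype.sum_prod_type]
  simp only [mul_sub, Finset.sum_sub_distrib, mul_ite, mul_one, mul_zero,
    Finset.sum_ite_irrel, Finset.sum_const_zero, Finset.sum_ite_eq', Finset.mem_univ, if_true]
  simp only [← Finset.sum_mul]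
  ring

theorem centering_apply (k l : Fin C × Fin N) : centering C N k l =
    (1 / ((C : ℝ) * N)) * ((if k = l then 1 else 0) - (1 / (N : ℝ)) * if k.1 = l.1 then 1 else 0) := by
  simp [centering, Matrix.mul_apply, labels, Matrix.one_apply, eq_comm]

theorem sum_centering (hN : N ≠ 0) (k : Fin C × Fin N) : ∑ l, centering C N k l = 0 := by
  have : (N : ℝ) ≠ 0 := by exact_mod_cast hN
  have h : ∑ l : Fin C × Fin N, (if k.1 = l.1 then (1 : ℝ) else 0) = N := by
    rw [Fintype.sum_prod_type, Finset.sum_comm]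
    simp
  simp only [centering_apply, ← Finset.mul_sum, Finset.sum_sub_distrib, h]
  simp [this]

theorem centering_transpose : (centering C N)ᵀ = centering C N := by
  ext i j; simp [centering_apply, eq_comm]

theorem labels_mul_centering (hN : N ≠ 0) : labels C N * centering C N = 0 := by
  have : (N : ℝ) ≠ 0 := by exact_mod_cast hN
  ext c ⟨d, j⟩
  simp [Matrix.mul_apply, centering_apply, labels, Fintype.sum_prod_type, Prod.ext_iff,
    ← Finset.mul_sum, Finset.sum_sub_distrib, ite_and]
  right
  split_ifs <;> simp [this]

theorem centering_mul_labels_transpose (hN : N ≠ 0) : centering C N * (labels C N)ᵀ = 0 := by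
  rw [← centering_transpose, ← Matrix.transpose_mul, labels_mul_centering hN,
    Matrix.transpose_zero]

theorem averaging_eq : averaging C N = (1 / (N : ℝ)) • ((labels C N)ᵀ * centeringProj C) := by
  ext k c
  simp [averaging, labels, Matrix.mul_apply]

theorem centering_mul_averaging (hN : N ≠ 0) : centering C N * averaging C N = 0 := by
  rw [averaging_eq, Matrix.mul_smul, ← Matrix.mul_assoc, centering_mul_labels_transpose hN,
    Matrix.zero_mul, smul_zero]

theorem averaging_transpose_mul_centering (hN : N ≠ 0) :
    (averaging C N)ᵀ * centering C N = 0 := by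
  have := congrArg Matrix.transpose (centering_mul_averaging (C := C) hN)
  rwa [Matrix.transpose_mul, centering_transpose, Matrix.transpose_zero] at this

theorem centering_mul_self (hN : N ≠ 0) :
    centering C N * centering C N = (1 / ((C : ℝ) * N)) • centering C N := by
  conv_lhs => enter [1]; rw [centering]
  rw [Matrix.smul_mul, Matrix.sub_mul, Matrix.smul_mul, Matrix.mul_assoc,
    labels_mul_centering hN]
  simp

theorem labels_mul_labels_transpose :
    labels C N * (labels C N)ᵀ = (N : ℝ) • (1 : Matrix (Fin C) (Fin C) ℝ) := by
  ext c d
  simp only [Matrix.mul_apply, labels, Fintype.sum_prod_type]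
  by_cases h : c = d <;> simp [h, Finset.sum_ite_irrel]

theorem labels_mul_averaging (hN : N ≠ 0) :
    labels C N * averaging C N = centeringProj C := by
  have : (N : ℝ) ≠ 0 := by exact_mod_cast hN
  rw [averaging_eq, Matrix.mul_smul, ← Matrix.mul_assoc, labels_mul_labels_transpose,
    Matrix.smul_mul, smul_smul]
  simp [this]

theorem averaging_transpose_mul_self (hC : C ≠ 0) (hN : N ≠ 0) :
    (averaging C N)ᵀ * averaging C N = (1 / (N : ℝ)) • centeringProj C := by
  conv_lhs => enter [1]; rw [averaging_eq]
  rw [Matrix.transpose_smul, Matrix.transpose_mul, Matrix.transpose_transpose, Matrix.smul_mul,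
    Matrix.mul_assoc, labels_mul_averaging hN, centeringProj_transpose, centeringProj_mul_self hC]

theorem sum_averaging (hC : C ≠ 0) (c : Fin C) : ∑ k, averaging C N k c = 0 := by
  simp [averaging, Fintype.sum_prod_type, ← Finset.mul_sum, sum_centeringProj' hC]

theorem sum_centeredMeans (hC : C ≠ 0) (X : Features P C N) (p : Fin P) :
    ∑ c, centeredMeans X p c = 0 := by
  simp only [centeredMeans_eq, Matrix.mul_apply]
  rw [Finset.sum_comm]
  simp [← Finset.mul_sum, averaging, sum_centeringProj hC]

theorem centeredMeans_mul_centeringProj (hC : C ≠ 0) (X : Features P C N) :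
    centeredMeans X * centeringProj C = centeredMeans X :=
  mul_centeringProj _ (sum_centeredMeans hC X)

theorem betweenCov_eq (X : Features P C N) :
    betweenCov X = (1 / (C : ℝ)) • (centeredMeans X * (centeredMeans X)ᵀ) := by
  ext p q
  simp [betweenCov, centeredMeans, Matrix.mul_apply, vecMulVec_apply, Matrix.sum_apply]

/-- The centered features, as deviations from the class means plus centered class means. -/
theorem centered_eq (hC : C ≠ 0) (hN : N ≠ 0) (X : Features P C N) :
    centered X = ((C : ℝ) * N) • (X * centering C N) + centeredMeans X * labels C N := by
  have h1 : (C : ℝ) ≠ 0 := by exact_mod_cast hC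
  have h2 : (N : ℝ) ≠ 0 := by exact_mod_cast hN
  ext p ⟨c, i⟩
  simp [centered, centeredMeans, labels, Matrix.mul_apply, centering_apply, classMean,
    Fintype.sum_prod_type, Prod.ext_iff, ite_and]
  simp [mul_sub, Finset.sum_sub_distrib, ← Finset.sum_mul]
  field_simp
  ring

theorem totalCov_eq (hC : C ≠ 0) (hN : N ≠ 0) (X : Features P C N) :
    totalCov X = withinCov X + (1 / (C : ℝ)) • (centeredMeans X * (centeredMeans X)ᵀ) := by
  have h1 : (C : ℝ) ≠ 0 := by exact_mod_cast hC
  have h2 : (N : ℝ) ≠ 0 := by exact_mod_cast hN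
  have e1 : X * centering C N * (X * centering C N)ᵀ = (1 / ((C : ℝ) * N)) • withinCov X := by
    rw [Matrix.transpose_mul, centering_transpose, Matrix.mul_assoc, ← Matrix.mul_assoc (centering C N),
      centering_mul_self hN, Matrix.smul_mul, Matrix.mul_smul, withinCov_eq, Matrix.mul_assoc]
  have e2 : X * centering C N * (centeredMeans X * labels C N)ᵀ = 0 := by
    rw [Matrix.transpose_mul, Matrix.mul_assoc, ← Matrix.mul_assoc (centering C N),
      centering_mul_labels_transpose hN]
    simp
  have e3 : centeredMeans X * labels C N * (X * centering C N)ᵀ = 0 := by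
    have := congrArg Matrix.transpose e2
    rwa [Matrix.transpose_mul, Matrix.transpose_transpose, Matrix.transpose_zero] at this
  have e4 : centeredMeans X * labels C N * (centeredMeans X * labels C N)ᵀ =
      (N : ℝ) • (centeredMeans X * (centeredMeans X)ᵀ) := by
    rw [Matrix.transpose_mul, Matrix.mul_assoc, ← Matrix.mul_assoc (labels C N),
      labels_mul_labels_transpose]
    simp
  rw [totalCov, centered_eq hC hN, Matrix.transpose_add, Matrix.transpose_smul, Matrix.add_mul,
    Matrix.mul_add, Matrix.mul_add, Matrix.smul_mul, Matrix.smul_mul, Matrix.mul_smul,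
    Matrix.mul_smul, e1, e2, e3, e4]
  simp only [smul_zero, add_zero, zero_add, smul_add, smul_smul]
  have c1 : 1 / ((C : ℝ) * N) * (C * N * (C * N * (1 / (C * N)))) = 1 := by field_simp
  have c2 : 1 / ((C : ℝ) * N) * N = 1 / C := by field_simp
  simp only [mul_assoc] at c1 c2 ⊢
  rw [c1, c2, one_smul]

/-! ### Closed form of the loss on the central path. -/

theorem posSemidef_mul_transpose {m n : Type*} [Fintype m] [Fintype n] (M : Matrix m n ℝ) :
    (M * Mᵀ).PosSemidef := by
  simpa [Matrix.conjTranspose_eq_transpose_of_trivial] using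
    Matrix.posSemidef_self_mul_conjTranspose M

/-- `1 + M Mᵀ / C` is invertible. -/
theorem isUnit_det_one_add (M : Matrix (Fin P) (Fin C) ℝ) :
    IsUnit ((1 : Matrix (Fin P) (Fin P) ℝ) + (1 / (C : ℝ)) • (M * Mᵀ)).det := by
  have h : ((1 : Matrix (Fin P) (Fin P) ℝ) + (1 / (C : ℝ)) • (M * Mᵀ)).PosDef :=
    Matrix.PosDef.one.add_posSemidef ((posSemidef_mul_transpose M).smul (by positivity))
  exact h.det_pos.ne'.isUnit

theorem transpose_one_add (M : Matrix (Fin P) (Fin C) ℝ) :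
    ((1 : Matrix (Fin P) (Fin P) ℝ) + (1 / (C : ℝ)) • (M * Mᵀ))ᵀ =
      1 + (1 / (C : ℝ)) • (M * Mᵀ) := by
  simp [Matrix.transpose_mul]

theorem totalCov_transpose (X : Features P C N) : (totalCov X)ᵀ = totalCov X := by
  simp [totalCov, Matrix.transpose_mul]

/-- The loss on the central path, up to a constant. -/
theorem lossLS_eq (hC : C ≠ 0) (hN : N ≠ 0) (X : Features P C N) (hX : IsUnit (totalCov X).det) :
    lossLS X = (1 / (2 * ((C : ℝ) * N))) * ∑ k : Fin C × Fin N, ∑ c, (1 / (C : ℝ) - labels C N c k) ^ 2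
      - (1 / (2 * (C : ℝ) ^ 2)) *
        ((centeredMeans X)ᵀ * (totalCov X)⁻¹ * centeredMeans X).trace := by
  have h1 : (C : ℝ) ≠ 0 := by exact_mod_cast hC
  have h2 : (N : ℝ) ≠ 0 := by exact_mod_cast hN
  set W := weightLS X with hW
  set E : Matrix (Fin C) (Fin C × Fin N) ℝ := Matrix.of fun c k => 1 / (C : ℝ) - labels C N c k with hE
  -- The bias cancels the global mean, so the residual is the classifier on centered features plus a
  -- part independent of `X`.
  have res : ∀ k c, (W * X) c k + biasLS X c - labels C N c k = (W * centered X + E) c k := by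
    intro k c
    have : (W * centered X) c k = (W * X) c k - (W *ᵥ globalMean X) c := by
      simp [Matrix.mul_apply, centered, mul_sub, Finset.sum_sub_distrib, Matrix.mulVec, dotProduct]
    rw [Matrix.add_apply, this, biasLS, hE, Matrix.of_apply]
    ring
  have tr : ∀ F : Matrix (Fin C) (Fin C × Fin N) ℝ, ∑ k, ∑ c, F c k ^ 2 = (F * Fᵀ).trace := by
    intro F
    rw [Finset.sum_comm]
    simp [Matrix.trace, Matrix.mul_apply, sq]
  -- Centered features annihilate the constant part of `E`; the labels contribute `N` times the
  -- class means.
  have cE : centered X * Eᵀ = -((N : ℝ) • centeredMeans X) := by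
    have : E = (Matrix.of fun _ _ => 1 / (C : ℝ)) - labels C N := by ext; simp [hE]
    rw [this, Matrix.transpose_sub, Matrix.mul_sub, centered_eq hC hN, Matrix.add_mul,
      Matrix.add_mul, Matrix.smul_mul, Matrix.smul_mul, Matrix.mul_assoc, Matrix.mul_assoc,
      Matrix.mul_assoc, Matrix.mul_assoc,
      centering_mul_labels_transpose hN, labels_mul_labels_transpose]
    have z1 : centering C N * (Matrix.of fun (_ : Fin C) (_ : Fin C × Fin N) => 1 / (C : ℝ))ᵀ = 0 := by
      ext k c
      simp [Matrix.mul_apply, ← Finset.sum_mul, sum_centering hN]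
    have z2 : centeredMeans X * (labels C N * (Matrix.of fun (_ : Fin C) (_ : Fin C × Fin N) => 1 / (C : ℝ))ᵀ) = 0 := by
      ext p c
      have : (labels C N * (Matrix.of fun (_ : Fin C) (_ : Fin C × Fin N) => 1 / (C : ℝ))ᵀ) =
          Matrix.of fun _ _ => (N : ℝ) / C := by
        ext c d
        simp only [Matrix.mul_apply, labels, Fintype.sum_prod_type, Matrix.of_apply,
          Matrix.transpose_apply]
        rw [Finset.sum_comm]
        simp [div_eq_mul_inv]
      rw [this]
      simp [Matrix.mul_apply, ← Finset.sum_mul, sum_centeredMeans hC]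
    rw [z1, z2]
    simp
  have cc : centered X * (centered X)ᵀ = ((C : ℝ) * N) • totalCov X := by
    rw [totalCov, smul_smul, mul_one_div_cancel (mul_ne_zero h1 h2), one_smul]
  have WM : W * totalCov X = (1 / (C : ℝ)) • (centeredMeans X)ᵀ := by
    rw [hW, weightLS, Matrix.smul_mul, Matrix.mul_assoc, Matrix.nonsing_inv_mul _ hX,
      Matrix.mul_one]
  set τ := ((centeredMeans X)ᵀ * (totalCov X)⁻¹ * centeredMeans X).trace with hτ
  have WT : Wᵀ = (1 / (C : ℝ)) • ((totalCov X)⁻¹ * centeredMeans X) := by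
    rw [hW, weightLS, Matrix.transpose_smul, Matrix.transpose_mul, Matrix.transpose_transpose,
      Matrix.transpose_nonsing_inv, totalCov_transpose]
  -- By the normal equations `WM` the quadratic term is `(N / C) τ` and each of the two cross terms
  -- is its negative, for a total of `-(N / C) τ`.
  have t1 : (W * centered X * (W * centered X)ᵀ).trace = (N / C : ℝ) * τ := by
    rw [Matrix.transpose_mul, Matrix.mul_assoc, ← Matrix.mul_assoc (centered X), cc,
      Matrix.smul_mul, Matrix.mul_smul, ← Matrix.mul_assoc, WM, WT]
    simp only [Matrix.smul_mul, Matrix.mul_smul, Matrix.trace_smul, ← Matrix.mul_assoc, smul_eq_mul]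
    rw [← hτ]
    field_simp
  have t2 : (W * centered X * Eᵀ).trace = -((N / C : ℝ) * τ) := by
    rw [Matrix.mul_assoc, cE, hW, weightLS]
    simp only [Matrix.smul_mul, Matrix.mul_smul, Matrix.mul_neg, Matrix.trace_neg,
      Matrix.trace_smul, smul_eq_mul]
    rw [← hτ]
    field_simp
  have t3 : (E * (W * centered X)ᵀ).trace = -((N / C : ℝ) * τ) := by
    rw [← t2, ← Matrix.trace_transpose, Matrix.transpose_mul, Matrix.transpose_transpose]
  rw [lossLS, mseLoss]
  simp only [← hW, res]
  rw [tr, Matrix.transpose_add, Matrix.add_mul, Matrix.mul_add, Matrix.mul_add, Matrix.trace_add,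
    Matrix.trace_add, Matrix.trace_add, t1, t2, t3, ← tr E]
  simp only [hE, Matrix.of_apply]
  field_simp
  ring

/-! ### Derivatives of matrix-valued functions, and the gradient of the loss -/

section MatrixCalculus

open scoped Matrix.Norms.Frobenius

variable {l m n : Type*} [Fintype l] [Fintype m] [Fintype n]

set_option linter.unusedSectionVars false

theorem hasDerivWithinAt_matrix {F : ℝ → Matrix m n ℝ} {F' : Matrix m n ℝ} {s : Set ℝ} {t : ℝ} :
    HasDerivWithinAt F F' s t ↔ ∀ i j, HasDerivWithinAt (fun x => F x i j) (F' i j) s t :=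
  ⟨fun h i j => hasDerivWithinAt_pi.1 (hasDerivWithinAt_pi.1 h i) j,
    fun h => hasDerivWithinAt_pi.2 fun i => hasDerivWithinAt_pi.2 fun j => h i j⟩

theorem hasDerivWithinAt_matrix_mul {F : ℝ → Matrix l m ℝ} {G : ℝ → Matrix m n ℝ}
    {F' : Matrix l m ℝ} {G' : Matrix m n ℝ} {s : Set ℝ} {t : ℝ}
    (hF : HasDerivWithinAt F F' s t) (hG : HasDerivWithinAt G G' s t) :
    HasDerivWithinAt (fun x => F x * G x) (F' * G t + F t * G') s t := by
  rw [hasDerivWithinAt_matrix] at *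
  intro i j
  simp only [Matrix.mul_apply, Matrix.add_apply, ← Finset.sum_add_distrib]
  exact HasDerivWithinAt.fun_sum fun k _ => (hF i k).mul (hG k j)

theorem hasDerivWithinAt_matrix_mul_const {F : ℝ → Matrix l m ℝ} {F' : Matrix l m ℝ} {s : Set ℝ}
    {t : ℝ} (hF : HasDerivWithinAt F F' s t) (G : Matrix m n ℝ) :
    HasDerivWithinAt (fun x => F x * G) (F' * G) s t := by
  simpa using hasDerivWithinAt_matrix_mul hF (hasDerivWithinAt_const t s G)

theorem hasDerivWithinAt_matrix_transpose {F : ℝ → Matrix m n ℝ} {F' : Matrix m n ℝ} {s : Set ℝ}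
    {t : ℝ} (hF : HasDerivWithinAt F F' s t) :
    HasDerivWithinAt (fun x => (F x)ᵀ) F'ᵀ s t := by
  rw [hasDerivWithinAt_matrix] at *
  exact fun i j => hF j i

theorem hasDerivWithinAt_matrix_trace {F : ℝ → Matrix m m ℝ} {F' : Matrix m m ℝ} {s : Set ℝ}
    {t : ℝ} (hF : HasDerivWithinAt F F' s t) :
    HasDerivWithinAt (fun x => (F x).trace) F'.trace s t := by
  rw [hasDerivWithinAt_matrix] at hF
  exact HasDerivWithinAt.fun_sum fun i _ => hF i i

theorem hasDerivWithinAt_matrix_inv [DecidableEq m] {F : ℝ → Matrix m m ℝ} {F' : Matrix m m ℝ}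
    {s : Set ℝ} {t : ℝ} (hF : HasDerivWithinAt F F' s t) (ht : IsUnit (F t).det) :
    HasDerivWithinAt (fun x => (F x)⁻¹) (-((F t)⁻¹ * F' * (F t)⁻¹)) s t := by
  obtain ⟨u, hu⟩ := (Matrix.isUnit_iff_isUnit_det _).2 ht
  have h := hasFDerivAt_ringInverse (𝕜 := ℝ) u
  rw [hu] at h
  have h2 := h.comp_hasDerivWithinAt t hF
  have hi : ((u⁻¹ : (Matrix m m ℝ)ˣ) : Matrix m m ℝ) = (F t)⁻¹ := by
    rw [← hu, Matrix.coe_units_inv]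
  rw [hi] at h2
  have hfun : (fun x => (F x)⁻¹) = Ring.inverse ∘ F := by
    ext1 x
    simp [Matrix.nonsing_inv_eq_ringInverse]
  rw [hfun]
  refine HasDerivWithinAt.congr_deriv h2 ?_
  simp

end MatrixCalculus

/-! ### The gradient of the loss on the manifold. -/

/-- `1 - S⁻¹ = Σ_B S⁻¹` for `S = 1 + Σ_B`. -/
theorem smul_mul_inv_one_add (M : Matrix (Fin P) (Fin C) ℝ) {S : Matrix (Fin P) (Fin P) ℝ}
    (hS : S = 1 + (1 / (C : ℝ)) • (M * Mᵀ)) :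
    (1 / (C : ℝ)) • (M * Mᵀ * S⁻¹) = 1 - S⁻¹ := by
  have h : (1 / (C : ℝ)) • (M * Mᵀ) = S - 1 := by rw [hS]; abel
  have hu : IsUnit S.det := hS ▸ isUnit_det_one_add M
  rw [← Matrix.smul_mul, h, Matrix.sub_mul, Matrix.mul_nonsing_inv _ hu, Matrix.one_mul]

theorem totalCov_eq_one_add (hC : C ≠ 0) (hN : N ≠ 0) {X : Features P C N}
    (hX : X ∈ manifold P C N) :
    totalCov X = 1 + (1 / (C : ℝ)) • (centeredMeans X * (centeredMeans X)ᵀ) := by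
  rw [totalCov_eq hC hN, show withinCov X = 1 from hX]

theorem isUnit_det_totalCov (hC : C ≠ 0) (hN : N ≠ 0) {X : Features P C N}
    (hX : X ∈ manifold P C N) : IsUnit (totalCov X).det := by
  rw [totalCov_eq_one_add hC hN hX]
  exact isUnit_det_one_add _

section

open scoped Matrix.Norms.Frobenius

/-- Differentiating `tr (Mᵀ S⁻¹ M)` gives `2 R M Aᵀ` from the two factors `M`, and from `S⁻¹` the
terms `-2 Q X K` (within-class) and `-(2 / C) Q M Aᵀ` (between-class), with `Q = R M Mᵀ R`. Since `Q
M / C = R M - R² M`, the terms in `R M` cancel and only `R² M Aᵀ - Q X K` survives, up to a factor.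
-/
theorem hasDerivAt_lossLS (hC : C ≠ 0) (hN : N ≠ 0) {X : Features P C N}
    (hX : X ∈ manifold P C N) (Z : Features P C N) :
    HasDerivAt (fun s : ℝ => lossLS (X + s • Z))
      (Zᵀ * ((-(1 / (C : ℝ) ^ 2)) •
        ((totalCov X)⁻¹ * (totalCov X)⁻¹ * centeredMeans X * (averaging C N)ᵀ -
          (totalCov X)⁻¹ * (centeredMeans X * (centeredMeans X)ᵀ) * (totalCov X)⁻¹ *
            (X * centering C N)))).trace 0 := by
  have hc : (C : ℝ) ≠ 0 := by exact_mod_cast hC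
  set A := averaging C N with hA
  set K := centering C N with hK
  set M := centeredMeans X with hM
  set S := totalCov X with hS
  set R := S⁻¹ with hR
  have hu := isUnit_det_totalCov hC hN hX
  have hS1 : S = 1 + (1 / (C : ℝ)) • (M * Mᵀ) := totalCov_eq_one_add hC hN hX
  have hRT : Rᵀ = R := by rw [hR, Matrix.transpose_nonsing_inv, hS, totalCov_transpose]
  have hMA : X * A = M := (centeredMeans_eq X).symm
  have S_eq : ∀ Y : Features P C N, totalCov Y =
      Y * K * Yᵀ + (1 / (C : ℝ)) • ((Y * A) * (Y * A)ᵀ) := fun Y => by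
    rw [totalCov_eq hC hN, withinCov_eq, centeredMeans_eq]
  have cX : Continuous fun s : ℝ => X + s • Z := by fun_prop
  have cS : Continuous fun s : ℝ => (totalCov (X + s • Z)).det := by
    simp only [S_eq]
    fun_prop
  -- The line `X + s • Z` leaves the manifold, so the closed form is used on a neighbourhood where
  -- the total covariance is still invertible.
  have ev : ∀ᶠ s : ℝ in 𝓝 0, IsUnit (totalCov (X + s • Z)).det := by
    have : (totalCov (X + (0 : ℝ) • Z)).det ≠ 0 := by simpa using hu.ne_zero
    exact (cS.continuousAt.eventually_ne this).mono fun s hs => hs.isUnit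
  have dX : HasDerivWithinAt (fun s : ℝ => X + s • Z) Z Set.univ 0 := by
    rw [hasDerivWithinAt_matrix]
    intro i j
    have := ((hasDerivAt_id (0 : ℝ)).mul_const (Z i j)).const_add (X i j)
    simpa using this
  have dM := hasDerivWithinAt_matrix_mul_const dX A
  have dS : HasDerivWithinAt (fun s : ℝ => totalCov (X + s • Z))
      (Z * K * Xᵀ + X * K * Zᵀ + (1 / (C : ℝ)) • (Z * A * Mᵀ + M * (Z * A)ᵀ)) Set.univ 0 := by
    simp only [S_eq]
    have h1 := hasDerivWithinAt_matrix_mul (hasDerivWithinAt_matrix_mul_const dX K)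
      (hasDerivWithinAt_matrix_transpose dX)
    have h2 := (hasDerivWithinAt_matrix_mul dM
      (hasDerivWithinAt_matrix_transpose dM)).const_smul (1 / (C : ℝ))
    have h3 := h1.add h2
    simp only [zero_smul, add_zero, hMA] at h3
    exact h3
  have dR := hasDerivWithinAt_matrix_inv dS (by simpa using hu)
  have dF := hasDerivWithinAt_matrix_trace (hasDerivWithinAt_matrix_mul
    (hasDerivWithinAt_matrix_mul (hasDerivWithinAt_matrix_transpose dM) dR) dM)
  have dL := (dF.const_mul (1 / (2 * (C : ℝ) ^ 2))).const_sub
    ((1 / (2 * ((C : ℝ) * N))) * ∑ k : Fin C × Fin N, ∑ c, (1 / (C : ℝ) - labels C N c k) ^ 2)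
  rw [hasDerivWithinAt_univ] at dL
  have dL2 := dL.congr_of_eventuallyEq (f₁ := fun s : ℝ => lossLS (X + s • Z))
    (ev.mono fun s hs => by beta_reduce; rw [lossLS_eq hC hN _ hs, centeredMeans_eq])
  refine dL2.congr_deriv (Eq.symm ?_)
  simp only [zero_smul, add_zero, hMA, ← hS, ← hR]
  set Q := R * (M * Mᵀ) * R with hQ
  have hQT : Qᵀ = Q := by
    simp only [hQ, Matrix.transpose_mul, hRT, Matrix.transpose_transpose, Matrix.mul_assoc]
  have t1 : ((Z * A)ᵀ * R * M).trace = (Zᵀ * (R * M * Aᵀ)).trace := by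
    rw [Matrix.transpose_mul, Matrix.mul_assoc, Matrix.mul_assoc, Matrix.trace_mul_comm]
    simp only [Matrix.mul_assoc]
  have t2 : (Mᵀ * R * (Z * A)).trace = (Zᵀ * (R * M * Aᵀ)).trace := by
    rw [← t1, ← Matrix.trace_transpose]
    simp only [Matrix.transpose_mul, hRT, Matrix.transpose_transpose, Matrix.mul_assoc]
  have t3 : ∀ D : Matrix (Fin P) (Fin P) ℝ, (Mᵀ * -(R * D * R) * M).trace = -(D * Q).trace := by
    intro D
    rw [Matrix.mul_neg, Matrix.neg_mul, Matrix.trace_neg, Matrix.trace_mul_comm, hQ,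
      ← Matrix.mul_assoc, ← Matrix.mul_assoc, ← Matrix.mul_assoc, Matrix.trace_mul_comm,
      Matrix.trace_mul_comm D]
    simp only [Matrix.mul_assoc]
  have t4 : (X * K * Zᵀ * Q).trace = (Zᵀ * (Q * (X * K))).trace := by
    rw [Matrix.mul_assoc, Matrix.trace_mul_comm, Matrix.mul_assoc]
  have t5 : (Z * K * Xᵀ * Q).trace = (Zᵀ * (Q * (X * K))).trace := by
    rw [← t4, ← Matrix.trace_transpose, Matrix.transpose_mul, hQT, Matrix.trace_mul_comm]
    simp only [Matrix.transpose_mul, hK, centering_transpose, Matrix.transpose_transpose,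
      Matrix.mul_assoc]
  have t6 : (M * (Z * A)ᵀ * Q).trace = (Zᵀ * (Q * M * Aᵀ)).trace := by
    rw [Matrix.trace_mul_comm, Matrix.trace_mul_comm Zᵀ, Matrix.transpose_mul]
    simp only [Matrix.mul_assoc]
  have t7 : (Z * A * Mᵀ * Q).trace = (Zᵀ * (Q * M * Aᵀ)).trace := by
    rw [← t6, ← Matrix.trace_transpose, Matrix.transpose_mul, hQT, Matrix.trace_mul_comm]
    simp only [Matrix.transpose_mul, Matrix.transpose_transpose, Matrix.mul_assoc]
  have key : (1 / (C : ℝ)) • (Q * M * Aᵀ) = R * M * Aᵀ - R * R * M * Aᵀ := by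
    have := smul_mul_inv_one_add M hS1
    rw [← hR] at this
    have h : (1 / (C : ℝ)) • (Q * M * Aᵀ) = R * ((1 / (C : ℝ)) • (M * Mᵀ * R)) * M * Aᵀ := by
      simp only [hQ, Matrix.mul_smul, Matrix.smul_mul, Matrix.mul_assoc]
    rw [h, this, Matrix.mul_sub, Matrix.sub_mul, Matrix.sub_mul, Matrix.mul_one]
  have keyt := congrArg (fun B => (Zᵀ * B).trace) key
  simp only [Matrix.mul_smul, Matrix.trace_smul, Matrix.mul_sub, Matrix.trace_sub,
    smul_eq_mul] at keyt
  simp only [Matrix.trace_add, Matrix.add_mul, t1, t2, t3, t4, t5, t6, t7, Matrix.smul_mul,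
    Matrix.trace_smul, smul_eq_mul, Matrix.mul_smul, Matrix.mul_sub, Matrix.trace_sub]
  have e : ∀ a b q m c : ℝ, c ≠ 0 → 1 / c * m = a - b →
      -(1 / c ^ 2) * (b - q) = -(1 / (2 * c ^ 2) * (a + -(q + q + 1 / c * (m + m)) + a)) := by
    intro a b q m c h0 h
    rw [show m + m = 2 * m by ring, mul_left_comm, h]
    field_simp
    ring
  exact e _ _ _ _ _ hc keyt

end

/-- The gradient of the loss on the central path at a renormalized feature matrix. -/
theorem gradLossLS_eq (hC : C ≠ 0) (hN : N ≠ 0) {X : Features P C N}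
    (hX : X ∈ manifold P C N) :
    gradLossLS X = (-(1 / (C : ℝ) ^ 2)) •
        ((totalCov X)⁻¹ * (totalCov X)⁻¹ * centeredMeans X * (averaging C N)ᵀ -
          (totalCov X)⁻¹ * (centeredMeans X * (centeredMeans X)ᵀ) * (totalCov X)⁻¹ *
            (X * centering C N)) := by
  ext p k
  rw [gradLossLS, Matrix.of_apply, (hasDerivAt_lossLS hC hN hX _).deriv]
  -- Pairing with an elementary matrix reads off a single entry of the gradient.
  rw [Matrix.transpose_single, Matrix.trace_single_mul, one_smul]

/-! ### The flow of the centered means and of the global mean -/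

/-- Grönwall with a time-dependent coefficient: continuity bounds it on the compact interval up to
`t`, which is all that is needed to reach `t`. -/
theorem eq_zero_of_norm_deriv_le {E : Type*} [NormedAddCommGroup E] [NormedSpace ℝ E]
    {f f' : ℝ → E} {b : ℝ → ℝ} (hb : ContinuousOn b (Set.Ici 0))
    (hf : ∀ t, 0 ≤ t → HasDerivWithinAt f (f' t) (Set.Ici 0) t) (h0 : f 0 = 0)
    (hle : ∀ t, 0 ≤ t → ‖f' t‖ ≤ b t * ‖f t‖) {t : ℝ} (ht : 0 ≤ t) : f t = 0 := by
  obtain ⟨B, hB⟩ := (isCompact_Icc (a := (0 : ℝ)) (b := t)).exists_bound_of_continuousOn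
    (hb.mono Set.Icc_subset_Ici_self)
  refine eq_zero_of_abs_deriv_le_mul_abs_self_of_eq_zero_right (f' := f') (K := B) (a := 0) (b := t)
    (fun s hs => ((hf s hs.1).continuousWithinAt).mono Set.Icc_subset_Ici_self)
    (fun s hs => (hf s hs.1).mono (Set.Ici_subset_Ici.2 hs.1)) h0 (fun s hs => ?_) t ⟨ht, le_rfl⟩
  refine (hle s hs.1).trans (mul_le_mul_of_nonneg_right ?_ (norm_nonneg _))
  exact (le_abs_self _).trans (hB s ⟨hs.1, hs.2.le⟩)

/-- `(1 + M Mᵀ / C)⁻¹`, the inverse total covariance of renormalized features with centered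
means `M`. -/
def resolvent (M : Matrix (Fin P) (Fin C) ℝ) : Matrix (Fin P) (Fin P) ℝ :=
  (1 + (1 / (C : ℝ)) • (M * Mᵀ))⁻¹

theorem resolvent_transpose (M : Matrix (Fin P) (Fin C) ℝ) : (resolvent M)ᵀ = resolvent M := by
  rw [resolvent, Matrix.transpose_nonsing_inv, transpose_one_add]

theorem smul_mul_resolvent (M : Matrix (Fin P) (Fin C) ℝ) :
    (1 / (C : ℝ)) • (M * Mᵀ * resolvent M) = 1 - resolvent M :=
  smul_mul_inv_one_add M rfl

/-- This identity turns the normal part of the gradient, seen on the means, into powers of the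
resolvent. -/
theorem smul_resolvent_mul_mul (M : Matrix (Fin P) (Fin C) ℝ) :
    (1 / (C : ℝ)) • (resolvent M * (M * Mᵀ) * resolvent M * M) =
      resolvent M * M - resolvent M * resolvent M * M := by
  have h : (1 / (C : ℝ)) • (resolvent M * (M * Mᵀ) * resolvent M * M) =
      resolvent M * ((1 / (C : ℝ)) • (M * Mᵀ * resolvent M)) * M := by
    simp only [Matrix.mul_smul, Matrix.smul_mul, Matrix.mul_assoc]
  rw [h, smul_mul_resolvent, Matrix.mul_sub, Matrix.sub_mul, Matrix.mul_one]

section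

open scoped Matrix.Norms.Frobenius

theorem continuousOn_resolvent {M : ℝ → Matrix (Fin P) (Fin C) ℝ} {s : Set ℝ}
    (hM : ContinuousOn M s) : ContinuousOn (fun t => resolvent (M t)) s := by
  intro t ht
  have h1 : ContinuousWithinAt (fun t => (1 : Matrix (Fin P) (Fin P) ℝ) +
      (1 / (C : ℝ)) • (M t * (M t)ᵀ)) s t := by
    have := hM t ht
    have h2 : Continuous fun A : Matrix (Fin P) (Fin C) ℝ => (1 : Matrix (Fin P) (Fin P) ℝ) +
      (1 / (C : ℝ)) • (A * Aᵀ) := by fun_prop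
    exact h2.continuousAt.comp_continuousWithinAt this
  obtain ⟨u, hu⟩ := (Matrix.isUnit_iff_isUnit_det _).2 (isUnit_det_one_add (M t))
  have h3 := NormedRing.inverse_continuousAt u
  rw [hu] at h3
  have h4 := h3.comp_continuousWithinAt (f := fun t => (1 : Matrix (Fin P) (Fin P) ℝ) +
      (1 / (C : ℝ)) • (M t * (M t)ᵀ)) h1
  have : (fun t => resolvent (M t)) = Ring.inverse ∘ fun t => (1 : Matrix (Fin P) (Fin P) ℝ) +
      (1 / (C : ℝ)) • (M t * (M t)ᵀ) := by
    ext1 x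
    simp [resolvent, Matrix.nonsing_inv_eq_ringInverse]
  rw [this]
  exact h4

theorem eq_zero_of_linear_ode {m n : Type*} [Fintype m] [Fintype n] {B : ℝ → Matrix m m ℝ}
    {f : ℝ → Matrix m n ℝ} (hB : ContinuousOn B (Set.Ici 0))
    (hf : ∀ t, 0 ≤ t → HasDerivWithinAt f (B t * f t) (Set.Ici 0) t) (h0 : f 0 = 0)
    {t : ℝ} (ht : 0 ≤ t) : f t = 0 := by
  have hb : ContinuousOn (fun t => ‖B t‖) (Set.Ici 0) := continuous_norm.comp_continuousOn hB
  exact eq_zero_of_norm_deriv_le hb hf h0 (fun s _ => Matrix.frobenius_norm_mul _ _) ht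

/-! ### The two tangent projections of the gradient and the induced flow of the means. -/

theorem gradLossLS_eq_resolvent (hC : C ≠ 0) (hN : N ≠ 0) {X : Features P C N}
    (hX : X ∈ manifold P C N) {M : Matrix (Fin P) (Fin C) ℝ} (hM : centeredMeans X = M) :
    gradLossLS X = (-(1 / (C : ℝ) ^ 2)) •
      (resolvent M * resolvent M * M * (averaging C N)ᵀ -
        resolvent M * (M * Mᵀ) * resolvent M * (X * centering C N)) := by
  rw [gradLossLS_eq hC hN hX, totalCov_eq_one_add hC hN hX, hM, resolvent]

/-- The term with `Aᵀ` is tangent because `Aᵀ K = 0`. The term `Q X K`, with `Q` symmetric, is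
normal: its product with `T` is half of `tr (Q (X K Tᵀ + T K Xᵀ))`, which vanishes for tangent `T`.
-/
theorem orthogonalProjection_grad (hC : C ≠ 0) (hN : N ≠ 0) {X V : Features P C N}
    (hX : X ∈ manifold P C N) (hV : IsOrthogonalProjection X (gradLossLS X) V)
    {M : Matrix (Fin P) (Fin C) ℝ} (hM : centeredMeans X = M) :
    V = (-(1 / (C : ℝ) ^ 2)) • (resolvent M * resolvent M * M * (averaging C N)ᵀ) := by
  set R := resolvent M
  set V₀ := (-(1 / (C : ℝ) ^ 2)) • (R * R * M * (averaging C N)ᵀ) with hV₀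
  set Q := R * (M * Mᵀ) * R with hQ
  have hQT : Qᵀ = Q := by
    simp only [hQ, Matrix.transpose_mul, R, resolvent_transpose, Matrix.transpose_transpose,
      Matrix.mul_assoc]
  have tan : V₀ ∈ tangentSpace X := by
    have h1 : V₀ * centering C N = 0 := by
      rw [hV₀, Matrix.smul_mul, Matrix.mul_assoc, averaging_transpose_mul_centering hN,
        Matrix.mul_zero, smul_zero]
    have h2 : centering C N * V₀ᵀ = 0 := by
      rw [← centering_transpose, ← Matrix.transpose_mul, h1, Matrix.transpose_zero]
    change _ = _
    rw [h1, Matrix.mul_assoc, h2]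
    simp
  have perp : ∀ T ∈ tangentSpace X, ((gradLossLS X - V₀)ᵀ * T).trace = 0 := by
    intro T hT
    have hT' : X * centering C N * Tᵀ + T * centering C N * Xᵀ = 0 := hT
    have h1 : gradLossLS X - V₀ = (1 / (C : ℝ) ^ 2) • (Q * (X * centering C N)) := by
      rw [gradLossLS_eq_resolvent hC hN hX hM, smul_sub, hV₀, sub_sub_cancel_left, neg_smul,
        neg_neg]
    have h2 : (Q * (X * centering C N * Tᵀ)).trace = ((Q * (X * centering C N))ᵀ * T).trace := by
      rw [← Matrix.mul_assoc, ← Matrix.trace_transpose, Matrix.trace_mul_comm,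
        Matrix.transpose_mul, Matrix.transpose_transpose, Matrix.trace_mul_comm]
    have h3 : (Q * (T * centering C N * Xᵀ)).trace = ((Q * (X * centering C N))ᵀ * T).trace := by
      rw [Matrix.transpose_mul, hQT, Matrix.transpose_mul, centering_transpose,
        Matrix.mul_assoc T, ← Matrix.mul_assoc Q, Matrix.trace_mul_comm, ← Matrix.mul_assoc]
    have h4 := congrArg (fun B => (Q * B).trace) hT'
    simp only [Matrix.mul_add, Matrix.trace_add, h2, h3, Matrix.mul_zero, Matrix.trace_zero] at h4
    rw [h1, Matrix.transpose_smul, Matrix.smul_mul, Matrix.trace_smul]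
    rw [show ((Q * (X * centering C N))ᵀ * T).trace = 0 by linarith, smul_zero]
  have tanD : V - V₀ ∈ tangentSpace X := by
    have h1 : X * centering C N * Vᵀ + V * centering C N * Xᵀ = 0 := hV.1
    have h2 : X * centering C N * V₀ᵀ + V₀ * centering C N * Xᵀ = 0 := tan
    change _ = _
    rw [Matrix.transpose_sub, Matrix.mul_sub, Matrix.sub_mul, Matrix.sub_mul,
      sub_add_sub_comm, h1, h2, sub_zero]
  have h1 := hV.2 _ tanD
  have h2 := perp _ tanD
  -- Uniqueness of the projection: `V - V₀` is both tangent and normal, hence orthogonal to itself.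
  have h3 : ((V - V₀)ᵀ * (V - V₀)).trace = 0 := by
    have : (V - V₀)ᵀ = (gradLossLS X - V₀)ᵀ - (gradLossLS X - V)ᵀ := by
      rw [← Matrix.transpose_sub]; congr 1; abel
    conv_lhs => enter [1, 1]; rw [this]
    rw [Matrix.sub_mul, Matrix.trace_sub, h1, h2, sub_zero]
  rw [← Matrix.conjTranspose_eq_transpose_of_trivial,
    Matrix.trace_conjTranspose_mul_self_eq_zero_iff] at h3
  exact sub_eq_zero.1 h3

/-- Only the normal term contributes to the correction, as `Aᵀ K = 0`. The identities `K² = K / (C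
N)` and `X K Xᵀ = 1` reduce it to a multiple of `Q`, with factor `1 / C² · 1 / (C N)`. -/
theorem renormalizingProjection_grad (hC : C ≠ 0) (hN : N ≠ 0) {X V : Features P C N}
    (hX : X ∈ manifold P C N) (hV : IsRenormalizingProjection X (gradLossLS X) V)
    {M : Matrix (Fin P) (Fin C) ℝ} (hM : centeredMeans X = M) :
    V = gradLossLS X -
      (1 / ((C : ℝ) ^ 3 * N)) • (resolvent M * (M * Mᵀ) * resolvent M * X) := by
  set R := resolvent M with hR
  set Q := R * (M * Mᵀ) * R with hQ
  have h1 : (C : ℝ) ≠ 0 := by exact_mod_cast hC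
  have h2 : (N : ℝ) ≠ 0 := by exact_mod_cast hN
  have hW : X * centering C N * Xᵀ = 1 := by rw [← withinCov_eq]; exact hX
  have hQT : Qᵀ = Q := by
    simp only [hQ, Matrix.transpose_mul, R, resolvent_transpose, Matrix.transpose_transpose,
      Matrix.mul_assoc]
  have h3 : gradLossLS X * centering C N * Xᵀ = (1 / ((C : ℝ) ^ 3 * N)) • Q := by
    rw [gradLossLS_eq_resolvent hC hN hX hM, Matrix.smul_mul, Matrix.sub_mul, Matrix.mul_assoc _ (averaging C N)ᵀ,
      averaging_transpose_mul_centering hN, Matrix.mul_zero, zero_sub, Matrix.mul_assoc _ (X * _),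
      Matrix.mul_assoc X, centering_mul_self hN, Matrix.mul_smul, Matrix.mul_smul, smul_neg,
      neg_smul, neg_neg, smul_smul, Matrix.smul_mul, Matrix.mul_assoc _ (X * _), hW, Matrix.mul_one]
    congr 1
    field_simp
  have h4 : X * centering C N * (gradLossLS X)ᵀ = (1 / ((C : ℝ) ^ 3 * N)) • Q := by
    have := congrArg Matrix.transpose h3
    rw [Matrix.transpose_smul, hQT] at this
    rw [← this, Matrix.transpose_mul, Matrix.transpose_mul, centering_transpose,
      Matrix.transpose_transpose, Matrix.mul_assoc]
  rw [hV, h3, h4, ← two_smul ℝ, smul_smul, Matrix.smul_mul, smul_smul,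
    ← mul_assoc, one_div_mul_cancel two_ne_zero, one_mul]

/-- The tangent term contributes `R² M` to the velocity of the means and the correction contributes
`R M - R² M`; the sum is a single power of `R`. -/
theorem renormalizedField_mul_averaging (hC : C ≠ 0) (hN : N ≠ 0) {X : Features P C N}
    {M : Matrix (Fin P) (Fin C) ℝ} (hM : X * averaging C N = M) :
    ((1 / (C : ℝ) ^ 2) • (resolvent M * resolvent M * M * (averaging C N)ᵀ -
        resolvent M * (M * Mᵀ) * resolvent M * (X * centering C N)) +
      (1 / ((C : ℝ) ^ 3 * N)) • (resolvent M * (M * Mᵀ) * resolvent M * X)) * averaging C N =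
      (1 / ((C : ℝ) ^ 2 * N)) • (resolvent M * M) := by
  have h1 : (C : ℝ) ≠ 0 := by exact_mod_cast hC
  have h2 : (N : ℝ) ≠ 0 := by exact_mod_cast hN
  have h3 := smul_resolvent_mul_mul M
  set R := resolvent M
  have h4 : (1 / ((C : ℝ) ^ 3 * N)) • (R * (M * Mᵀ) * R * M) =
      (1 / ((C : ℝ) ^ 2 * N)) • (R * M - R * R * M) := by
    rw [← h3, smul_smul]
    congr 1
    field_simp
  have h5 : M * centeringProj C = M := by
    rw [← hM, ← centeredMeans_eq, centeredMeans_mul_centeringProj hC]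
  rw [Matrix.add_mul, Matrix.smul_mul, Matrix.sub_mul, Matrix.mul_assoc _ _ (averaging C N),
    averaging_transpose_mul_self hC hN, Matrix.mul_smul, Matrix.mul_assoc _ M, h5,
    Matrix.mul_assoc _ (X * centering C N), Matrix.mul_assoc X,
    centering_mul_averaging hN, Matrix.mul_zero, Matrix.mul_zero, sub_zero, smul_smul,
    Matrix.smul_mul, Matrix.mul_assoc _ X, hM, h4, smul_sub,
    show 1 / (C : ℝ) ^ 2 * (1 / N) = 1 / ((C : ℝ) ^ 2 * N) by field_simp]
  abel

/-- For `o` a constant column, `X * o` is proportional to the global mean; it obeys a homogeneous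
linear equation and so remains zero once zero. -/
theorem renormalizedField_mul_of_eq_zero {X : Features P C N} {M : Matrix (Fin P) (Fin C) ℝ}
    {o : Matrix (Fin C × Fin N) Unit ℝ} (hKo : centering C N * o = 0)
    (hAo : (averaging C N)ᵀ * o = 0) (a b : ℝ) :
    (a • (resolvent M * resolvent M * M * (averaging C N)ᵀ -
        resolvent M * (M * Mᵀ) * resolvent M * (X * centering C N)) +
      b • (resolvent M * (M * Mᵀ) * resolvent M * X)) * o =
      (b • (resolvent M * (M * Mᵀ) * resolvent M)) * (X * o) := by
  rw [Matrix.add_mul, Matrix.smul_mul, Matrix.sub_mul, Matrix.mul_assoc _ (X * centering C N),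
    Matrix.mul_assoc X, hKo, Matrix.mul_assoc _ (averaging C N)ᵀ, hAo, Matrix.mul_zero,
    Matrix.mul_zero, Matrix.mul_zero, sub_zero, smul_zero, zero_add, Matrix.smul_mul,
    Matrix.smul_mul, Matrix.mul_assoc _ X]

/-- Along the flow the centered means follow `M' = κ R^k M`, with `R` the resolvent of `M` and
`k = 2` or `k = 1` for the two projections; and the global mean stays zero. -/
theorem flow_means (hC : C ≠ 0) (hN : N ≠ 0) {X : ℝ → Features P C N}
    (hflow : IsRenormalizedFlow X) (h0 : globalMean (X 0) = 0) :
    (∃ k : ℕ, (k = 1 ∨ k = 2) ∧ ∀ t, 0 ≤ t → HasDerivWithinAt (fun s => centeredMeans (X s))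
      ((1 / ((C : ℝ) ^ 2 * N)) • (resolvent (centeredMeans (X t)) ^ k * centeredMeans (X t)))
      (Set.Ici 0) t) ∧ ∀ t, 0 ≤ t → globalMean (X t) = 0 := by
  have h1 : (C : ℝ) ≠ 0 := by exact_mod_cast hC
  have h2 : (N : ℝ) ≠ 0 := by exact_mod_cast hN
  -- Right multiplication by this column is the global mean.
  set o : Matrix (Fin C × Fin N) Unit ℝ := Matrix.of fun _ _ => 1 / ((C : ℝ) * N) with ho
  have hg : ∀ Y : Features P C N, ∀ p, globalMean Y p = (Y * o) p () := by
    intro Y p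
    simp [globalMean, ho, Matrix.mul_apply, ← Finset.sum_mul, mul_comm]
  have hKo : centering C N * o = 0 := by
    ext k c
    simp [ho, Matrix.mul_apply, ← Finset.sum_mul, sum_centering hN]
  have hAo : (averaging C N)ᵀ * o = 0 := by
    ext k c
    simp [ho, Matrix.mul_apply, ← Finset.sum_mul, sum_averaging hC]
  have hz : X 0 * o = 0 := by
    ext p u
    rw [← hg, h0]
    rfl
  have aux : ∀ (M : Matrix (Fin P) (Fin C) ℝ) (Y : Features P C N), centeredMeans Y = M →
      resolvent M * resolvent M * M * (averaging C N)ᵀ * averaging C N =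
        (1 / (N : ℝ)) • (resolvent M * resolvent M * M) := by
    intro M Y hM
    rw [Matrix.mul_assoc, averaging_transpose_mul_self hC hN, Matrix.mul_smul, Matrix.mul_assoc,
      ← hM, centeredMeans_mul_centeringProj hC]
  have gz : (∀ t, 0 ≤ t → X t * o = 0) → ∀ t, 0 ≤ t → globalMean (X t) = 0 := by
    intro h t ht
    ext p
    rw [hg, h t ht]
    rfl
  simp only [centeredMeans_eq (P := P) (C := C) (N := N)]
  rcases hflow with hflow | hflow
  · have hd : ∀ t, 0 ≤ t → HasDerivWithinAt X ((1 / (C : ℝ) ^ 2) •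
        (resolvent (X t * averaging C N) * resolvent (X t * averaging C N) *
          (X t * averaging C N) * (averaging C N)ᵀ)) (Set.Ici 0) t := by
      intro t ht
      obtain ⟨hX, V, hV, hder⟩ := hflow t ht
      rw [orthogonalProjection_grad hC hN hX hV (centeredMeans_eq _)] at hder
      refine HasDerivWithinAt.congr_deriv (hasDerivWithinAt_matrix.2 fun p k => hder p k) ?_
      ext p k
      simp
    refine ⟨⟨2, Or.inr rfl, fun t ht => ?_⟩, gz fun t ht => ?_⟩
    · refine (hasDerivWithinAt_matrix_mul_const (hd t ht) (averaging C N)).congr_deriv ?_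
      rw [Matrix.smul_mul, aux _ (X t) (centeredMeans_eq _), smul_smul,
        show 1 / (C : ℝ) ^ 2 * (1 / N) = 1 / ((C : ℝ) ^ 2 * N) by field_simp,
        pow_two (resolvent _)]
    -- For the orthogonal projection the global mean has zero derivative, hence the zero
    -- coefficient.
    · refine eq_zero_of_norm_deriv_le (f := fun t => X t * o) (b := fun _ => 0) continuousOn_const
        (fun s hs => hasDerivWithinAt_matrix_mul_const (hd s hs) o) hz (fun s hs => ?_) ht
      rw [Matrix.smul_mul, Matrix.mul_assoc, hAo]
      simp
  · have hd : ∀ t, 0 ≤ t → HasDerivWithinAt X ((1 / (C : ℝ) ^ 2) •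
        (resolvent (X t * averaging C N) * resolvent (X t * averaging C N) *
          (X t * averaging C N) * (averaging C N)ᵀ -
        resolvent (X t * averaging C N) * (X t * averaging C N * (X t * averaging C N)ᵀ) *
          resolvent (X t * averaging C N) * (X t * centering C N)) +
        (1 / ((C : ℝ) ^ 3 * N)) • (resolvent (X t * averaging C N) *
          (X t * averaging C N * (X t * averaging C N)ᵀ) *
          resolvent (X t * averaging C N) * X t)) (Set.Ici 0) t := by
      intro t ht
      obtain ⟨hX, V, hV, hder⟩ := hflow t ht
      rw [renormalizingProjection_grad hC hN hX hV (centeredMeans_eq _),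
        gradLossLS_eq_resolvent hC hN hX (centeredMeans_eq _)] at hder
      refine HasDerivWithinAt.congr_deriv
        ((hasDerivWithinAt_matrix (F' := -_)).2 fun p k => hder p k) ?_
      rw [neg_sub, neg_smul, sub_neg_eq_add, add_comm]
    have hcM : ContinuousOn (fun t => X t * averaging C N) (Set.Ici 0) := fun t ht =>
      (hasDerivWithinAt_matrix_mul_const (hd t ht) _).continuousWithinAt
    have hcR := continuousOn_resolvent hcM
    refine ⟨⟨1, Or.inl rfl, fun t ht => ?_⟩, gz fun t ht => ?_⟩
    · refine (hasDerivWithinAt_matrix_mul_const (hd t ht) (averaging C N)).congr_deriv ?_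
      rw [renormalizedField_mul_averaging hC hN rfl, pow_one]
    · have c1 : Continuous fun Z : Matrix (Fin P) (Fin P) ℝ × Matrix (Fin P) (Fin C) ℝ =>
          (1 / ((C : ℝ) ^ 3 * N)) • (Z.1 * (Z.2 * Z.2ᵀ) * Z.1) := by fun_prop
      refine eq_zero_of_linear_ode (f := fun t => X t * o) (c1.comp_continuousOn (hcR.prodMk hcM))
        (fun s hs => ?_) hz ht
      have := hasDerivWithinAt_matrix_mul_const (hd s hs) o
      rwa [renormalizedField_mul_of_eq_zero hKo hAo] at this

end

/-! ### Singular values along the flow -/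

/-- The scalar equation `ω' = κ ω / (1 + ω² / c) ^ k`, solved by inverting the function
`log ω + p ω`, which grows linearly along solutions. -/
theorem exists_scalar_solution {κ c : ℝ} (hκ : 0 < κ) (hc : 0 < c) (k : ℕ) {p p' : ℝ → ℝ}
    (hp : ∀ y, HasDerivAt p (p' y) y) (hpk : ∀ y, 1 + y * p' y = (1 + y ^ 2 / c) ^ k)
    (hp0 : ∀ y, 0 ≤ p y) {a : ℝ} (ha : 0 < a) :
    ∃ ω : ℝ → ℝ, ω 0 = a ∧ (∀ t, 0 < ω t) ∧
      (∀ t, HasDerivAt ω (κ * (((1 + ω t ^ 2 / c)⁻¹) ^ k * ω t)) t) ∧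
      (∀ t, Real.log (ω t) + p (ω t) = Real.log a + p a + κ * t) ∧ Tendsto ω atTop atTop := by
  -- In the coordinate `x = log ω` the equation reads `(φ x)' = κ`, since `hpk` makes the derivative
  -- of `φ` equal to `(1 + exp x ^ 2 / c) ^ k`. The solution is the inverse of `φ` along an affine
  -- function of time.
  set φ : ℝ → ℝ := fun x => x + p (Real.exp x) with hφ
  have hpos : ∀ x, 0 < (1 + Real.exp x ^ 2 / c) ^ k := fun x => by positivity
  have hd : ∀ x, HasDerivAt φ ((1 + Real.exp x ^ 2 / c) ^ k) x := by
    intro x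
    rw [← hpk, mul_comm]
    exact (hasDerivAt_id x).add ((hp _).comp x (Real.hasDerivAt_exp x))
  have hmono : StrictMono φ := strictMono_of_hasDerivAt_pos hd hpos
  have hcont : Continuous φ := continuous_iff_continuousAt.2 fun x => (hd x).continuousAt
  have hpc : Continuous p := continuous_iff_continuousAt.2 fun x => (hp x).continuousAt
  have hsurj : Function.Surjective φ := by
    refine hcont.surjective (tendsto_atTop_mono (fun x => ?_) tendsto_id) ?_
    · simpa [hφ] using hp0 _
    -- As `x → -∞`, `exp x → 0` and `p (exp x)` tends to the finite value `p 0`.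
    · exact tendsto_id.atBot_add ((hpc.tendsto 0).comp Real.tendsto_exp_atBot)
  set e : ℝ ≃o ℝ := StrictMono.orderIsoOfSurjective φ hmono hsurj with he
  have hφe : ∀ y, φ (e.symm y) = y := fun y => e.apply_symm_apply y
  have heφ : ∀ x, e.symm (φ x) = x := fun x => e.symm_apply_apply x
  have hde : ∀ y, HasDerivAt e.symm ((1 + Real.exp (e.symm y) ^ 2 / c) ^ k)⁻¹ y := fun y =>
    HasDerivAt.of_local_left_inverse e.symm.continuous.continuousAt (hd _) (hpos _).ne'
      (Eventually.of_forall hφe)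
  refine ⟨fun t => Real.exp (e.symm (φ (Real.log a) + κ * t)), ?_, fun t => Real.exp_pos _, ?_, ?_,
    ?_⟩
  · simp [heφ, Real.exp_log ha]
  · intro t
    have h1 : HasDerivAt (fun t : ℝ => φ (Real.log a) + κ * t) κ t := by
      simpa using ((hasDerivAt_id t).const_mul κ).const_add (φ (Real.log a))
    refine ((hde _).comp t h1).exp.congr_deriv ?_
    rw [inv_pow]
    simp only [Function.comp]
    ring
  · intro t
    have h1 := hφe (φ (Real.log a) + κ * t)
    simp only [Real.log_exp]
    conv_rhs at h1 => simp only [hφ, Real.exp_log ha]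
    exact h1
  · refine Real.tendsto_exp_atTop.comp (e.symm.tendsto_atTop.comp ?_)
    exact tendsto_atTop_add_const_left _ _ (tendsto_id.const_mul_atTop hκ)

/-- A common potential for the two exponents. -/
theorem exists_potential {c : ℝ} (hc : 0 < c) {k : ℕ} (hk : k = 1 ∨ k = 2) :
    ∃ p p' : ℝ → ℝ, (∀ y, HasDerivAt p (p' y) y) ∧
      (∀ y, 1 + y * p' y = (1 + y ^ 2 / c) ^ k) ∧ (∀ y, 0 ≤ p y) ∧
      ∀ y z, 0 ≤ z → z ≤ y → (y ^ 2 - z ^ 2) / (2 * c) ≤ p y - p z := by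
  have h2 : ∀ y : ℝ, HasDerivAt (fun y => y ^ 2 / (2 * c)) (y / c) y := by
    intro y
    refine ((hasDerivAt_pow 2 y).div_const (2 * c)).congr_deriv ?_
    field_simp
    simp
  rcases hk with rfl | rfl
  · refine ⟨fun y => y ^ 2 / (2 * c), fun y => y / c, h2, fun y => ?_, fun y => by positivity,
      fun y z _ _ => ?_⟩
    · field_simp
    · exact le_of_eq (by ring)
  -- Integrating `((1 + y² / c)² - 1) / y` gives `y² / c + y⁴ / (4 c²)`. It is split so that the
  -- potential for `k = 1` stands apart from a remainder that is increasing on `y ≥ 0`.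
  · refine ⟨fun y => y ^ 2 / (2 * c) + (y ^ 2 / (2 * c) + y ^ 4 / (4 * c ^ 2)),
      fun y => y / c + (y / c + y ^ 3 / c ^ 2), fun y => ?_, fun y => ?_, fun y => by positivity,
      fun y z hz hzy => ?_⟩
    · refine (h2 y).add ((h2 y).add
        (((hasDerivAt_pow 4 y).div_const (4 * c ^ 2)).congr_deriv ?_))
      field_simp
      simp
    · field_simp
      ring
    · have e2 : z ^ 2 / (2 * c) ≤ y ^ 2 / (2 * c) := by gcongr
      have e4 : z ^ 4 / (4 * c ^ 2) ≤ y ^ 4 / (4 * c ^ 2) := by gcongr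
      have e0 : (y ^ 2 - z ^ 2) / (2 * c) = y ^ 2 / (2 * c) - z ^ 2 / (2 * c) := by ring
      linarith

/-- For `z ≤ y` the logarithms and the potentials differ in the same direction, so the gap of `p`
alone is at most `d`, and it dominates the gap of `y² / (2c)`. -/
theorem abs_sq_sub_sq_le {c : ℝ} (hc : 0 < c) {p : ℝ → ℝ}
    (hp : ∀ y z, 0 ≤ z → z ≤ y → (y ^ 2 - z ^ 2) / (2 * c) ≤ p y - p z) {y z d : ℝ}
    (hy : 0 < y) (hz : 0 < z) (h : Real.log y + p y - (Real.log z + p z) = d) :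
    |y ^ 2 - z ^ 2| ≤ 2 * c * |d| := by
  wlog hzy : z ≤ y generalizing y z d
  · rw [abs_sub_comm, ← abs_neg d]
    exact this hz hy (by rw [← h]; ring) (le_of_not_ge hzy)
  · have h1 := hp y z hz.le hzy
    have h2 := Real.log_le_log hz hzy
    have h3 := le_abs_self d
    have h4 : z ^ 2 ≤ y ^ 2 := by gcongr
    rw [abs_of_nonneg (by linarith)]
    rw [div_le_iff₀ (by positivity)] at h1
    have : p y - p z ≤ |d| := by linarith
    nlinarith

/-! ### Uniqueness for the flow of the means and its explicit solution. -/

section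

open scoped Matrix.Norms.Frobenius

theorem resolvent_sub_resolvent (M₁ M₂ : Matrix (Fin P) (Fin C) ℝ) :
    resolvent M₁ - resolvent M₂ = -(resolvent M₁ *
      ((1 / (C : ℝ)) • ((M₁ - M₂) * M₁ᵀ + M₂ * (M₁ - M₂)ᵀ)) * resolvent M₂) := by
  have h1 := isUnit_det_one_add M₁
  have h2 := isUnit_det_one_add M₂
  have h3 : (1 / (C : ℝ)) • ((M₁ - M₂) * M₁ᵀ + M₂ * (M₁ - M₂)ᵀ) =
      (1 + (1 / (C : ℝ)) • (M₁ * M₁ᵀ)) - (1 + (1 / (C : ℝ)) • (M₂ * M₂ᵀ)) := by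
    rw [add_sub_add_left_eq_sub, ← smul_sub, Matrix.sub_mul, Matrix.transpose_sub, Matrix.mul_sub]
    congr 1
    abel
  rw [h3, resolvent, resolvent, Matrix.mul_sub, Matrix.nonsing_inv_mul _ h1, Matrix.sub_mul,
    Matrix.mul_assoc, Matrix.mul_nonsing_inv _ h2, Matrix.one_mul, Matrix.mul_one, neg_sub]

theorem norm_resolvent_sub_resolvent_le (M₁ M₂ : Matrix (Fin P) (Fin C) ℝ) :
    ‖resolvent M₁ - resolvent M₂‖ ≤
      ‖resolvent M₁‖ * ((1 / (C : ℝ)) * (‖M₁‖ + ‖M₂‖)) * ‖resolvent M₂‖ * ‖M₁ - M₂‖ := by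
  rw [resolvent_sub_resolvent, norm_neg]
  have h1 : ‖(1 / (C : ℝ)) • ((M₁ - M₂) * M₁ᵀ + M₂ * (M₁ - M₂)ᵀ)‖ ≤
      (1 / (C : ℝ)) * (‖M₁‖ + ‖M₂‖) * ‖M₁ - M₂‖ := by
    rw [norm_smul, Real.norm_of_nonneg (by positivity), mul_assoc]
    refine mul_le_mul_of_nonneg_left ((norm_add_le _ _).trans ?_) (by positivity)
    rw [add_mul, mul_comm ‖M₁‖]
    refine add_le_add ((Matrix.frobenius_norm_mul _ _).trans ?_)
      ((Matrix.frobenius_norm_mul _ _).trans ?_)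
    · rw [Matrix.frobenius_norm_transpose]
    · rw [Matrix.frobenius_norm_transpose]
  calc _ ≤ ‖resolvent M₁ * ((1 / (C : ℝ)) • ((M₁ - M₂) * M₁ᵀ + M₂ * (M₁ - M₂)ᵀ))‖ *
        ‖resolvent M₂‖ := Matrix.frobenius_norm_mul _ _
    _ ≤ ‖resolvent M₁‖ * ((1 / (C : ℝ)) * (‖M₁‖ + ‖M₂‖) * ‖M₁ - M₂‖) * ‖resolvent M₂‖ := by
        gcongr
        refine (Matrix.frobenius_norm_mul _ _).trans ?_
        gcongr
    _ = _ := by ring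

/-- The Lipschitz coefficient is needed only along two given trajectories and only has to be
continuous in time, so no uniform estimate of the resolvent enters. -/
theorem exists_lipschitz_bound {M₁ M₂ : ℝ → Matrix (Fin P) (Fin C) ℝ} {s : Set ℝ}
    (h₁ : ContinuousOn M₁ s) (h₂ : ContinuousOn M₂ s) (k : ℕ) :
    ∃ b : ℝ → ℝ, ContinuousOn b s ∧ (∀ t, 0 ≤ b t) ∧ ∀ t,
      ‖resolvent (M₁ t) ^ k * M₁ t - resolvent (M₂ t) ^ k * M₂ t‖ ≤ b t * ‖M₁ t - M₂ t‖ := by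
  have n₁ : ContinuousOn (fun t => ‖M₁ t‖) s := continuous_norm.comp_continuousOn h₁
  have n₂ : ContinuousOn (fun t => ‖M₂ t‖) s := continuous_norm.comp_continuousOn h₂
  have r₁ : ContinuousOn (fun t => ‖resolvent (M₁ t)‖) s :=
    continuous_norm.comp_continuousOn (continuousOn_resolvent h₁)
  have r₂ : ContinuousOn (fun t => ‖resolvent (M₂ t)‖) s :=
    continuous_norm.comp_continuousOn (continuousOn_resolvent h₂)
  -- Proved for every exponent before the induction on `k`, because the coefficient at each stage
  -- contains the norm of the previous power.
  have f₂ : ∀ k : ℕ, ContinuousOn (fun t => resolvent (M₂ t) ^ k * M₂ t) s := by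
    intro k
    induction k with
    | zero => simpa using h₂
    | succ k ih =>
      simp only [pow_succ', Matrix.mul_assoc]
      have c1 : Continuous fun Z : Matrix (Fin P) (Fin P) ℝ × Matrix (Fin P) (Fin C) ℝ =>
          Z.1 * Z.2 := by fun_prop
      exact c1.comp_continuousOn ((continuousOn_resolvent h₂).prodMk ih)
  induction k with
  | zero => exact ⟨fun _ => 1, continuousOn_const, fun _ => zero_le_one, fun t => by simp⟩
  | succ k ih =>
    obtain ⟨b, hb, hb0, hle⟩ := ih
    refine ⟨fun t => ‖resolvent (M₁ t)‖ * b t + ‖resolvent (M₁ t)‖ *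
      ((1 / (C : ℝ)) * (‖M₁ t‖ + ‖M₂ t‖)) * ‖resolvent (M₂ t)‖ *
        ‖resolvent (M₂ t) ^ k * M₂ t‖,
      (r₁.mul hb).add (((r₁.mul (continuousOn_const.mul (n₁.add n₂))).mul r₂).mul
        (continuous_norm.comp_continuousOn (f₂ k))),
      fun t => ?_, fun t => ?_⟩
    · have := hb0 t
      positivity
    have e : resolvent (M₁ t) ^ (k + 1) * M₁ t - resolvent (M₂ t) ^ (k + 1) * M₂ t =
        resolvent (M₁ t) * (resolvent (M₁ t) ^ k * M₁ t - resolvent (M₂ t) ^ k * M₂ t) +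
        (resolvent (M₁ t) - resolvent (M₂ t)) * (resolvent (M₂ t) ^ k * M₂ t) := by
      rw [Matrix.mul_sub, Matrix.sub_mul, pow_succ', pow_succ', Matrix.mul_assoc, Matrix.mul_assoc]
      abel
    rw [e]
    refine (norm_add_le _ _).trans ?_
    rw [add_mul]
    refine add_le_add ((Matrix.frobenius_norm_mul _ _).trans ?_)
      ((Matrix.frobenius_norm_mul _ _).trans ?_)
    · rw [mul_assoc]
      exact mul_le_mul_of_nonneg_left (hle t) (norm_nonneg _)
    · refine (mul_le_mul_of_nonneg_right (norm_resolvent_sub_resolvent_le _ _)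
        (norm_nonneg _)).trans (le_of_eq ?_)
      ring

theorem means_flow_unique {M₁ M₂ : ℝ → Matrix (Fin P) (Fin C) ℝ} {κ : ℝ} {k : ℕ}
    (h₁ : ∀ t, 0 ≤ t → HasDerivWithinAt M₁ (κ • (resolvent (M₁ t) ^ k * M₁ t)) (Set.Ici 0) t)
    (h₂ : ∀ t, 0 ≤ t → HasDerivWithinAt M₂ (κ • (resolvent (M₂ t) ^ k * M₂ t)) (Set.Ici 0) t)
    (h0 : M₁ 0 = M₂ 0) {t : ℝ} (ht : 0 ≤ t) : M₁ t = M₂ t := by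
  obtain ⟨b, hb, -, hle⟩ := exists_lipschitz_bound (s := Set.Ici 0)
    (fun t ht => (h₁ t ht).continuousWithinAt) (fun t ht => (h₂ t ht).continuousWithinAt) k
  refine sub_eq_zero.1 (eq_zero_of_norm_deriv_le (f := fun t => M₁ t - M₂ t)
    (b := fun t => ‖κ‖ * b t) (continuousOn_const.mul hb)
    (fun s hs => (h₁ s hs).sub (h₂ s hs)) (sub_eq_zero.2 h0) (fun s hs => ?_) ht)
  rw [← smul_sub, norm_smul, mul_assoc]
  exact mul_le_mul_of_nonneg_left (hle s) (norm_nonneg _)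

/-- The columns of `U` are eigenvectors of `1 + M Mᵀ / C` with eigenvalues `1 + ω_j² / C`. The
diagonal `d` is arbitrary so that the identity can be iterated. -/
theorem resolvent_mul_svd {r : ℕ} {U : Matrix (Fin P) (Fin r) ℝ} {V : Matrix (Fin C) (Fin r) ℝ}
    (hU : Uᵀ * U = 1) (hV : Vᵀ * V = 1) (ω d : Fin r → ℝ) :
    resolvent (U * diagonal ω * Vᵀ) * (U * diagonal d) =
      U * diagonal fun j => (1 + ω j ^ 2 / C)⁻¹ * d j := by
  set e : Fin r → ℝ := fun j => (1 + ω j ^ 2 / C)⁻¹ * d j with he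
  have hpos : ∀ j, (1 + ω j ^ 2 / (C : ℝ)) ≠ 0 := fun j => by positivity
  have h1 : (1 + (1 / (C : ℝ)) • (U * diagonal ω * Vᵀ * (U * diagonal ω * Vᵀ)ᵀ)) *
      (U * diagonal e) = U * diagonal d := by
    have h2 : U * diagonal ω * Vᵀ * (U * diagonal ω * Vᵀ)ᵀ * (U * diagonal e) =
        U * diagonal fun j => ω j * (ω j * e j) := by
      simp only [Matrix.transpose_mul, Matrix.transpose_transpose, Matrix.diagonal_transpose]
      calc _ = U * diagonal ω * (Vᵀ * V) * diagonal ω * (Uᵀ * U) * diagonal e := by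
            simp only [Matrix.mul_assoc]
        _ = _ := by
          rw [hU, hV, Matrix.mul_one, Matrix.mul_one, Matrix.mul_assoc, Matrix.mul_assoc,
            Matrix.diagonal_mul_diagonal, Matrix.diagonal_mul_diagonal]
    rw [Matrix.add_mul, Matrix.one_mul, Matrix.smul_mul, h2, ← Matrix.mul_smul, ← Matrix.mul_add,
      ← Matrix.diagonal_smul, Matrix.diagonal_add]
    congr 2
    ext j
    have := hpos j
    simp only [he, Pi.smul_apply, smul_eq_mul]
    field_simp
  rw [resolvent, ← h1, ← Matrix.mul_assoc, Matrix.nonsing_inv_mul _ (isUnit_det_one_add _),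
    Matrix.one_mul]

theorem resolvent_pow_mul_svd {r : ℕ} {U : Matrix (Fin P) (Fin r) ℝ}
    {V : Matrix (Fin C) (Fin r) ℝ} (hU : Uᵀ * U = 1) (hV : Vᵀ * V = 1) (ω : Fin r → ℝ) (k : ℕ) :
    resolvent (U * diagonal ω * Vᵀ) ^ k * (U * diagonal ω * Vᵀ) =
      U * diagonal (fun j => ((1 + ω j ^ 2 / C)⁻¹) ^ k * ω j) * Vᵀ := by
  induction k with
  | zero => simp
  | succ k ih =>
    rw [pow_succ', Matrix.mul_assoc, ih, ← Matrix.mul_assoc, resolvent_mul_svd hU hV]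
    simp only [pow_succ', mul_assoc]

/-- Along the flow of the centered means the singular vectors are constant, the singular values
go to infinity, and the differences of their squares stay bounded. -/
theorem means_flow_svd (hC : C ≠ 0) {M : ℝ → Matrix (Fin P) (Fin C) ℝ} {κ : ℝ} (hκ : 0 < κ)
    {k : ℕ} (hk : k = 1 ∨ k = 2)
    (hM : ∀ t, 0 ≤ t → HasDerivWithinAt M (κ • (resolvent (M t) ^ k * M t)) (Set.Ici 0) t)
    {r : ℕ} {U : Matrix (Fin P) (Fin r) ℝ} {V : Matrix (Fin C) (Fin r) ℝ} {ω₀ : Fin r → ℝ}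
    (h0 : IsCompactSVD (M 0) U ω₀ V) :
    ∃ ω : ℝ → Fin r → ℝ, (∀ t, 0 ≤ t → IsCompactSVD (M t) U (ω t) V) ∧
      (∀ j, Tendsto (fun t => ω t j) atTop atTop) ∧
      ∀ i j, ∃ B, ∀ t, |ω t i ^ 2 - ω t j ^ 2| ≤ B := by
  have hc : 0 < (C : ℝ) := by exact_mod_cast Nat.pos_of_ne_zero hC
  obtain ⟨p, p', hp, hpk, hp0, hpd⟩ := exists_potential hc hk
  choose ω hω0 hωpos hωd hωp hωlim using fun j : Fin r =>
    exists_scalar_solution hκ hc k hp hpk hp0 (h0.pos j)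
  -- With frozen singular vectors and the scalar solutions on the diagonal one gets a solution with
  -- the same initial value; uniqueness identifies it with `M`.
  have hsol : ∀ t, 0 ≤ t → M t = U * diagonal (fun j => ω j t) * Vᵀ := by
    intro t ht
    refine means_flow_unique (M₂ := fun t => U * diagonal (fun j => ω j t) * Vᵀ) hM
      (fun s hs => ?_) ?_ ht
    · have hD : HasDerivWithinAt (fun t => (diagonal (fun j => ω j t) : Matrix (Fin r) (Fin r) ℝ))
          (diagonal fun j => κ * (((1 + ω j s ^ 2 / C)⁻¹) ^ k * ω j s)) (Set.Ici 0) s := by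
        rw [hasDerivWithinAt_matrix]
        intro i j
        by_cases hij : i = j
        · subst hij
          simpa using (hωd i s).hasDerivWithinAt
        · simpa [hij] using hasDerivWithinAt_const s (Set.Ici 0) (0 : ℝ)
      have h1 := hasDerivWithinAt_matrix_mul_const
        (hasDerivWithinAt_matrix_mul (hasDerivWithinAt_const s (Set.Ici 0) U) hD) Vᵀ
      refine h1.congr_deriv ?_
      rw [resolvent_pow_mul_svd h0.left_orthonormal h0.right_orthonormal, Matrix.zero_mul, zero_add,
        ← Matrix.smul_mul, ← Matrix.mul_smul, ← Matrix.diagonal_smul]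
      rfl
    · simp only [hω0]
      exact h0.eq
  refine ⟨fun t j => ω j t, fun t ht => ⟨h0.left_orthonormal, h0.right_orthonormal,
    fun j => hωpos j t, hsol t ht⟩, hωlim, fun i j => ?_⟩
  -- The growth `κ * t` is common to all singular values, so it cancels in the difference and `d`
  -- depends only on the initial values.
  exact ⟨_, fun t => abs_sq_sub_sq_le hc hpd (hωpos i t) (hωpos j t)
    (d := Real.log (ω₀ i) + p (ω₀ i) - (Real.log (ω₀ j) + p (ω₀ j)))
    (by rw [hωp, hωp]; ring)⟩

end

/-! ### Compact singular value decompositions -/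

/-- With `W` an orthonormal eigenbasis of `Sᵀ S`, the columns of `S W` are orthogonal with squared
lengths the eigenvalues. Keeping the nonzero ones, whose number is the rank, and normalizing gives
`U`. -/
theorem exists_isCompactSVD (S : Matrix (Fin P) (Fin C) ℝ) :
    ∃ U ω V, IsCompactSVD (r := S.rank) S U ω V := by
  have hA : (Sᵀ * S).IsHermitian := by
    simpa using Matrix.isHermitian_conjTranspose_mul_self S
  set W : Matrix (Fin C) (Fin C) ℝ := (hA.eigenvectorUnitary : Matrix (Fin C) (Fin C) ℝ) with hW
  have hWW : Wᵀ * W = 1 := by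
    have := Unitary.coe_star_mul_self hA.eigenvectorUnitary
    rwa [Matrix.star_eq_conjTranspose, Matrix.conjTranspose_eq_transpose_of_trivial] at this
  have hWW' : W * Wᵀ = 1 := mul_eq_one_comm.1 hWW
  have hdiag : (S * W)ᵀ * (S * W) = diagonal hA.eigenvalues := by
    have := hA.conjStarAlgAut_star_eigenvectorUnitary
    rw [Unitary.conjStarAlgAut_star_apply, Matrix.star_eq_conjTranspose,
      Matrix.conjTranspose_eq_transpose_of_trivial] at this
    rw [Matrix.transpose_mul, ← Matrix.mul_assoc, Matrix.mul_assoc Wᵀ, this]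
    rfl
  have hentry : ∀ i j, ∑ p, (S * W) p i * (S * W) p j = if i = j then hA.eigenvalues i else 0 := by
    intro i j
    have := congrFun (congrFun hdiag i) j
    rwa [Matrix.diagonal_apply] at this
  have hzero : ∀ i, hA.eigenvalues i = 0 → ∀ p, (S * W) p i = 0 := by
    intro i hi p
    have h1 := hentry i i
    rw [if_pos rfl, hi, Finset.sum_eq_zero_iff_of_nonneg fun p _ => mul_self_nonneg _] at h1
    exact mul_self_eq_zero.1 (h1 p (Finset.mem_univ _))
  have hnonneg : ∀ i, 0 ≤ hA.eigenvalues i := by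
    intro i
    have h1 := hentry i i
    rw [if_pos rfl] at h1
    rw [← h1]
    exact Finset.sum_nonneg fun p _ => mul_self_nonneg _
  have hcard : Fintype.card (Fin S.rank) = Fintype.card {i // hA.eigenvalues i ≠ 0} := by
    rw [← hA.rank_eq_card_non_zero_eigs, Matrix.rank_transpose_mul_self, Fintype.card_fin]
  let e := Fintype.equivOfCardEq hcard
  have hpos : ∀ j, 0 < hA.eigenvalues (e j) := fun j => (hnonneg _).lt_of_ne' (e j).2
  have hinj : ∀ i j, ((e i : Fin C) = e j) = (i = j) := fun i j =>
    propext ⟨fun h => e.injective (Subtype.ext h), fun h => h ▸ rfl⟩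
  refine ⟨Matrix.of fun p j => (S * W) p (e j) * (√(hA.eigenvalues (e j)))⁻¹,
    fun j => √(hA.eigenvalues (e j)), Matrix.of fun c j => W c (e j), ?_, ?_,
    fun j => Real.sqrt_pos.2 (hpos j), ?_⟩
  · ext i j
    have h1 := hentry (e i) (e j)
    simp only [Matrix.mul_apply (M := (Matrix.of _)ᵀ), Matrix.transpose_apply, Matrix.of_apply,
      Matrix.one_apply]
    have h2 : ∀ p, (S * W) p (e i) * (√(hA.eigenvalues (e i)))⁻¹ *
        ((S * W) p (e j) * (√(hA.eigenvalues (e j)))⁻¹) =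
        (S * W) p (e i) * (S * W) p (e j) *
          ((√(hA.eigenvalues (e i)))⁻¹ * (√(hA.eigenvalues (e j)))⁻¹) := fun p => by ring
    simp only [h2]
    rw [← Finset.sum_mul, h1]
    simp only [hinj]
    split_ifs with hij
    · subst hij
      rw [← mul_inv, Real.mul_self_sqrt (hnonneg _), mul_inv_cancel₀ (hpos i).ne']
    · simp
  · ext i j
    have h1 := congrFun (congrFun hWW (e i)) (e j)
    simp only [Matrix.one_apply, hinj] at h1
    rw [Matrix.one_apply, ← h1]
    rfl
  · ext p c
    have h1 : S p c = ∑ i, (S * W) p i * W c i := by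
      have : S = S * W * Wᵀ := by rw [Matrix.mul_assoc, hWW', Matrix.mul_one]
      conv_lhs => rw [this]
      rfl
    -- Columns of `S W` with eigenvalue zero vanish, so dropping them loses nothing.
    have h2 : ∑ i, (S * W) p i * W c i =
        ∑ i : {i // hA.eigenvalues i ≠ 0}, (S * W) p i * W c i := by
      rw [← Finset.sum_subtype (Finset.univ.filter fun i => hA.eigenvalues i ≠ 0) (by simp)
        fun i => (S * W) p i * W c i, Finset.sum_filter_of_ne]
      intro i _ hi h0
      exact hi (by rw [hzero i h0, zero_mul])
    rw [h1, h2, ← e.sum_comp, Matrix.mul_apply]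
    refine Finset.sum_congr rfl fun j _ => ?_
    rw [Matrix.mul_diagonal, Matrix.of_apply, Matrix.transpose_apply, Matrix.of_apply,
      inv_mul_cancel_right₀ (Real.sqrt_pos.2 (hpos j)).ne']

namespace IsCompactSVD

variable {r : ℕ} {S : Matrix (Fin P) (Fin C) ℝ} {U : Matrix (Fin P) (Fin r) ℝ}
  {ω : Fin r → ℝ} {V : Matrix (Fin C) (Fin r) ℝ}

theorem transpose_mul_mul (h : IsCompactSVD S U ω V) : Uᵀ * S = diagonal ω * Vᵀ := by
  rw [h.eq, Matrix.mul_assoc, ← Matrix.mul_assoc, h.left_orthonormal, Matrix.one_mul]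

theorem transpose_mul_self (h : IsCompactSVD S U ω V) :
    Sᵀ * S = V * diagonal (fun j => ω j ^ 2) * Vᵀ := by
  conv_lhs => enter [1]; rw [h.eq]
  rw [Matrix.transpose_mul, Matrix.transpose_mul, Matrix.transpose_transpose,
    Matrix.diagonal_transpose, Matrix.mul_assoc, Matrix.mul_assoc, h.transpose_mul_mul,
    ← Matrix.mul_assoc (diagonal ω), Matrix.diagonal_mul_diagonal, Matrix.mul_assoc]
  simp only [sq]

theorem ne_zero (h : IsCompactSVD S U ω V) (j : Fin r) : S ≠ 0 := by
  rintro rfl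
  have h1 := congrArg (· * V) h.transpose_mul_mul
  simp only [Matrix.mul_zero, Matrix.zero_mul, Matrix.mul_assoc, h.right_orthonormal,
    Matrix.mul_one] at h1
  have := congrFun (congrFun h1 j) j
  simp only [Matrix.diagonal_apply_eq, Matrix.zero_apply] at this
  exact (h.pos j).ne this

/-- The largest singular value is one of the singular values of the decomposition. -/
theorem exists_maxSingularValue_eq (h : IsCompactSVD S U ω V) (j₀ : Fin r) :
    ∃ j, maxSingularValue S = ω j := by
  set T := Matrix.toEuclideanLin S with hT
  have hT0 : T ≠ 0 := by
    rw [hT, Ne, LinearEquiv.map_eq_zero_iff]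
    exact h.ne_zero j₀
  -- Positivity is needed twice: to have a nonzero eigenvalue of `Sᵀ S`, so that `Vᵀ v ≠ 0`, and to
  -- take the square root at the end.
  have hσ : 0 < T.singularValues 0 := by
    rw [LinearMap.singularValues_pos_iff_ne_zero]
    intro h0
    apply hT0
    rw [← LinearMap.singularValues_eq_zero_iff]
    ext i
    exact le_antisymm ((T.singularValues_antitone (Nat.zero_le i)).trans_eq h0)
      (T.singularValues_nonneg i)
  have hrank : 0 < Module.finrank ℝ (EuclideanSpace ℝ (Fin C)) := by
    by_contra hn
    rw [T.singularValues_of_finrank_le (not_lt.1 hn)] at hσ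
    exact lt_irrefl _ hσ
  obtain ⟨v, hv⟩ := (T.hasEigenvalue_adjoint_comp_self_sq_singularValues hrank).exists_hasEigenvector
  have hv0 : v.ofLp ≠ 0 := fun h0 => hv.2 ((WithLp.ofLp_eq_zero 2).1 h0)
  have hv1 : (Sᵀ * S) *ᵥ v.ofLp = (T.singularValues 0 ^ 2) • v.ofLp := by
    have := congrArg WithLp.ofLp hv.apply_eq_smul
    rw [hT, ← Matrix.toEuclideanLin_conjTranspose_eq_adjoint] at this
    simpa [Matrix.mulVec_mulVec] using this
  set y := Vᵀ *ᵥ v.ofLp with hy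
  have h1 : V *ᵥ (diagonal (fun j => ω j ^ 2) *ᵥ y) = (T.singularValues 0 ^ 2) • v.ofLp := by
    rw [← hv1, h.transpose_mul_self, hy, Matrix.mulVec_mulVec, Matrix.mulVec_mulVec,
      Matrix.mul_assoc]
  have h2 : diagonal (fun j => ω j ^ 2) *ᵥ y = (T.singularValues 0 ^ 2) • y := by
    have := congrArg (Vᵀ *ᵥ ·) h1
    simpa [Matrix.mulVec_mulVec, ← Matrix.mul_assoc, h.right_orthonormal, Matrix.mulVec_smul]
      using this
  obtain ⟨j, hj⟩ : ∃ j, y j ≠ 0 := by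
    by_contra! hn
    have : y = 0 := funext hn
    rw [this, Matrix.mulVec_zero, Matrix.mulVec_zero] at h1
    exact (smul_ne_zero (pow_ne_zero 2 hσ.ne') hv0) h1.symm
  refine ⟨j, ?_⟩
  have h3 := congrFun h2 j
  rw [Matrix.mulVec_diagonal, Pi.smul_apply, smul_eq_mul] at h3
  have h4 := mul_right_cancel₀ hj h3
  exact ((sq_eq_sq₀ (h.pos j).le hσ.le).1 h4).symm

/-- The right singular vectors of a matrix with centered rows are centered. -/
theorem sum_right (h : IsCompactSVD S U ω V) (hS : ∀ p, ∑ c, S p c = 0) (j : Fin r) :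
    ∑ c, V c j = 0 := by
  have h1 : ∀ c, ∑ p, U p j * S p c = ω j * V c j := by
    intro c
    have := congrFun (congrFun h.transpose_mul_mul j) c
    rwa [Matrix.diagonal_mul] at this
  have h2 : ω j * ∑ c, V c j = 0 := by
    rw [Finset.mul_sum, ← Finset.sum_congr rfl fun c _ => h1 c, Finset.sum_comm]
    simp [← Finset.mul_sum, hS]
  exact (mul_eq_zero.1 h2).resolve_left (h.pos j).ne'

end IsCompactSVD

/-- A full system of centered orthonormal vectors resolves the centering projection. -/
theorem mul_transpose_eq_centeringProj (hC : 2 ≤ C) {V : Matrix (Fin C) (Fin (C - 1)) ℝ}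
    (hV : Vᵀ * V = 1) (hsum : ∀ j, ∑ c, V c j = 0) : V * Vᵀ = centeringProj C := by
  have hc : (0 : ℝ) < C := by exact_mod_cast (by omega : 0 < C)
  set a : ℝ := (√(C : ℝ))⁻¹ with ha
  have haa : a * a = 1 / (C : ℝ) := by
    rw [ha, ← mul_inv, Real.mul_self_sqrt hc.le, one_div]
  -- The normalized ones vector completes the columns of `V` to a square orthogonal matrix, whose
  -- rows are then orthonormal as well.
  set o : Matrix (Fin C) Unit ℝ := Matrix.of fun _ _ => a with ho
  have hoo : oᵀ * o = 1 := by
    ext i j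
    simp [Matrix.mul_apply, ho, haa, hc.ne']
  have hVo : Vᵀ * o = 0 := by
    ext i j
    simp [Matrix.mul_apply, ho, ← Finset.sum_mul, hsum]
  have hoV : oᵀ * V = 0 := by
    have := congrArg Matrix.transpose hVo
    rwa [Matrix.transpose_mul, Matrix.transpose_transpose, Matrix.transpose_zero] at this
  have h1 : (Matrix.fromCols V o)ᵀ * Matrix.fromCols V o = 1 := by
    rw [Matrix.transpose_fromCols, Matrix.fromRows_mul_fromCols, hV, hVo, hoV, hoo,
      Matrix.fromBlocks_one]
  have hcard : Fintype.card (Fin (C - 1) ⊕ Unit) = Fintype.card (Fin C) := by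
    simp
    omega
  have h2 := (Matrix.mul_eq_one_comm_of_equiv (Fintype.equivOfCardEq hcard)).1 h1
  rw [Matrix.transpose_fromCols, Matrix.fromCols_mul_fromRows] at h2
  rw [eq_sub_of_add_eq h2, centeringProj]
  congr 1
  ext i j
  simp [Matrix.mul_apply, ho, haa]

/-! ### The Moore–Penrose pseudoinverse -/

/-- `A B` and `A B'` are both the orthogonal projection onto the range of `A`, hence equal; likewise
`B A = B' A`. Then `B = B A B = B' A B = B' A B' = B'`. -/
theorem IsMoorePenrose.unique {A B B' : Matrix (Fin P) (Fin P) ℝ} (h : IsMoorePenrose A B)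
    (h' : IsMoorePenrose A B') : B = B' := by
  have h1 : A * B = A * B' := by
    have : A * B = A * B' * (A * B) := by rw [← Matrix.mul_assoc, h'.mul_mul_left]
    have h2 := congrArg Matrix.transpose this
    rw [Matrix.transpose_mul (A * B'), h.symm_left, h'.symm_left, ← Matrix.mul_assoc,
      h.mul_mul_left] at h2
    exact h2
  have h2 : B * A = B' * A := by
    have : B * A = B * A * (B' * A) := by rw [Matrix.mul_assoc, ← Matrix.mul_assoc A, h'.mul_mul_left]
    have h2 := congrArg Matrix.transpose this
    rw [Matrix.transpose_mul (B * A), h.symm_right, h'.symm_right, Matrix.mul_assoc,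
      ← Matrix.mul_assoc A, h.mul_mul_left] at h2
    exact h2
  rw [← h.mul_mul_right, h2, Matrix.mul_assoc, h1, ← Matrix.mul_assoc, h'.mul_mul_right]

theorem pinv_eq {A B : Matrix (Fin P) (Fin P) ℝ} (h : IsMoorePenrose A B) : pinv A = B := by
  have hex : ∃ B, IsMoorePenrose A B := ⟨B, h⟩
  rw [pinv, dif_pos hex]
  exact hex.choose_spec.unique h

/-- Matrices `U diag(d) Uᵀ` are symmetric and multiply like their diagonals, so the pseudoinverse
inverts the diagonal. -/
theorem IsCompactSVD.pinv_smul_mul_transpose {r : ℕ} {S : Matrix (Fin P) (Fin C) ℝ}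
    {U : Matrix (Fin P) (Fin r) ℝ} {ω : Fin r → ℝ} {V : Matrix (Fin C) (Fin r) ℝ}
    (h : IsCompactSVD S U ω V) {c : ℝ} (hc : c ≠ 0) :
    pinv (c • (S * Sᵀ)) = U * diagonal (fun j => (c * ω j ^ 2)⁻¹) * Uᵀ := by
  have hS : c • (S * Sᵀ) = U * diagonal (fun j => c * ω j ^ 2) * Uᵀ := by
    conv_lhs => rw [h.eq]
    rw [Matrix.transpose_mul, Matrix.transpose_mul, Matrix.transpose_transpose,
      Matrix.diagonal_transpose]
    calc _ = c • (U * diagonal ω * (Vᵀ * V) * (diagonal ω * Uᵀ)) := by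
          simp only [Matrix.mul_assoc]
      _ = _ := by
        rw [h.right_orthonormal, Matrix.mul_one, Matrix.mul_assoc, ← Matrix.mul_assoc (diagonal ω),
          Matrix.diagonal_mul_diagonal, ← Matrix.mul_smul, ← Matrix.smul_mul, ← Matrix.diagonal_smul,
          ← Matrix.mul_assoc]
        congr 3
        ext j
        simp [sq]
  have key : ∀ d e : Fin r → ℝ, U * diagonal d * Uᵀ * (U * diagonal e * Uᵀ) =
      U * diagonal (fun j => d j * e j) * Uᵀ := by
    intro d e
    calc _ = U * diagonal d * (Uᵀ * U) * (diagonal e * Uᵀ) := by simp only [Matrix.mul_assoc]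
      _ = _ := by
        rw [h.left_orthonormal, Matrix.mul_one, Matrix.mul_assoc, ← Matrix.mul_assoc (diagonal d),
          Matrix.diagonal_mul_diagonal, Matrix.mul_assoc]
  have hsymm : ∀ d : Fin r → ℝ, (U * diagonal d * Uᵀ)ᵀ = U * diagonal d * Uᵀ := by
    intro d
    simp [Matrix.transpose_mul, Matrix.mul_assoc]
  have hne : ∀ j, c * ω j ^ 2 ≠ 0 := fun j => mul_ne_zero hc (pow_ne_zero 2 (h.pos j).ne')
  refine pinv_eq ?_
  rw [hS]
  refine ⟨?_, ?_, ?_, ?_⟩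
  · rw [key, key]
    simp only [mul_inv_cancel₀ (hne _), one_mul]
  · rw [key, key]
    simp only [inv_mul_cancel₀ (hne _), one_mul]
  · rw [key, hsymm]
  · rw [key, hsymm]

/-! ### Decision rules -/

/-- If finitely many scores converge to limits with a unique maximizer, then it is eventually the
unique maximizer of the scores. -/
theorem eventually_argmax_eq {f : ℝ → Fin C → ℝ} {a : Fin C → ℝ} {c : Fin C}
    (hf : ∀ d, Tendsto (fun t => f t d) atTop (𝓝 (a d))) (ha : ∀ d, d ≠ c → a d < a c) :
    ∀ᶠ t in atTop, {d | ∀ d', f t d' ≤ f t d} = {c} := by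
  have h : ∀ᶠ t in atTop, ∀ d, d ≠ c → f t d < f t c := by
    rw [eventually_all]
    intro d
    by_cases hd : d = c
    · exact Eventually.of_forall fun t h => absurd hd h
    · exact ((hf d).eventually_lt (hf c) (ha d hd)).mono fun t ht _ => ht
  refine h.mono fun t ht => Set.ext fun d => ⟨fun hd => ?_, fun hd d' => ?_⟩
  · by_contra hne
    exact absurd (hd c) (not_le.2 (ht d hne))
  · rw [Set.mem_singleton_iff] at hd
    subst hd
    by_cases h : d' = d
    · rw [h]
    · exact (ht d' h).le

/-- Zero global mean makes all biases equal, and positive factors do not move the maximizer. The two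
factors allow the weights and the input to be rescaled separately to have limits. -/
theorem classifierDecision_eq {X : Features P C N} (hX : globalMean X = 0) {s r : ℝ} (hs : 0 < s)
    (hr : 0 < r) (h : EuclideanSpace ℝ (Fin P)) :
    classifierDecision X h = {d | ∀ d', ((s • (weightLS X)ᵀ)ᵀ *ᵥ (r • h.ofLp)) d' ≤
      ((s • (weightLS X)ᵀ)ᵀ *ᵥ (r • h.ofLp)) d} := by
  have hb : ∀ d, biasLS X d = 1 / (C : ℝ) := fun d => by simp [biasLS, hX]
  have hi : ∀ d, ((s • (weightLS X)ᵀ)ᵀ *ᵥ (r • h.ofLp)) d = (s * r) * inner ℝ (weightVec X d) h := by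
    intro d
    simp only [PiLp.inner_apply, weightVec, Matrix.mulVec, dotProduct, Finset.mul_sum]
    refine Finset.sum_congr rfl fun p _ => ?_
    simp
    ring
  ext d
  simp only [classifierDecision, Set.mem_ofPred_eq, hb, hi, add_le_add_iff_right,
    mul_le_mul_iff_right₀ (mul_pos hs hr)]

theorem meanVec_eq {X : Features P C N} (hX : globalMean X = 0) (c : Fin C) :
    meanVec X c = centeredMeanVec X c := by
  simp [meanVec, centeredMeanVec, centeredMeans, hX]

theorem nearestMeanDecision_eq {X : Features P C N} (hX : globalMean X = 0) {s : ℝ} (hs : 0 < s)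
    (h : EuclideanSpace ℝ (Fin P)) :
    nearestMeanDecision X h = {d | ∀ d', -‖s • h - s • centeredMeanVec X d'‖ ≤
      -‖s • h - s • centeredMeanVec X d‖} := by
  ext d
  simp only [nearestMeanDecision, Set.mem_ofPred_eq, meanVec_eq hX, ← smul_sub, norm_smul,
    neg_le_neg_iff, Real.norm_of_nonneg hs.le, mul_le_mul_iff_right₀ hs]

/-- Form for a fixed input: expanding the squared distance, `‖h‖²` drops out, and a common `a` may
be subtracted from the diverging squared norms of the means before rescaling. -/
theorem nearestMeanDecision_eq' {X : Features P C N} (hX : globalMean X = 0) {s : ℝ} (hs : 0 < s)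
    (a : ℝ) (h : EuclideanSpace ℝ (Fin P)) :
    nearestMeanDecision X h = {d | ∀ d',
      inner ℝ (s • centeredMeanVec X d') h - s * (‖centeredMeanVec X d'‖ ^ 2 - a) / 2 ≤
      inner ℝ (s • centeredMeanVec X d) h - s * (‖centeredMeanVec X d‖ ^ 2 - a) / 2} := by
  ext d
  simp only [nearestMeanDecision, Set.mem_ofPred_eq, meanVec_eq hX]
  refine forall_congr' fun d' => ?_
  rw [← sq_le_sq₀ (norm_nonneg _) (norm_nonneg _), norm_sub_sq_real, norm_sub_sq_real,
    real_inner_comm, real_inner_comm (centeredMeanVec X d'), real_inner_smul_left,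
    real_inner_smul_left]
  rw [← mul_le_mul_iff_right₀ hs]
  constructor <;> intro h <;> linarith

/-! ### Asymptotics of the features -/

/-- Renormalized, globally centered features whose centered means have constant singular vectors,
with singular values going to infinity and whose squares stay at bounded distance; `ρ` is one of
the singular values at each time. -/
structure IsCollapsing (X : ℝ → Features P C N) (U : Matrix (Fin P) (Fin (C - 1)) ℝ)
    (ω : ℝ → Fin (C - 1) → ℝ) (V : Matrix (Fin C) (Fin (C - 1)) ℝ) (ρ : ℝ → ℝ) : Prop where
  two_le : 2 ≤ C
  ne_zero : N ≠ 0
  mem : ∀ t, 0 ≤ t → X t ∈ manifold P C N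
  mean : ∀ t, 0 ≤ t → globalMean (X t) = 0
  svd : ∀ t, 0 ≤ t → IsCompactSVD (centeredMeans (X t)) U (ω t) V
  tendsto : ∀ j, Tendsto (fun t => ω t j) atTop atTop
  scale : ∀ t, 0 ≤ t → ∃ j, ρ t = ω t j
  bounded : ∀ i j, ∃ B, ∀ t, |ω t i ^ 2 - ω t j ^ 2| ≤ B

/-- The `c`-th column as a Euclidean vector. -/
def colVec (E : Matrix (Fin P) (Fin C) ℝ) (c : Fin C) : EuclideanSpace ℝ (Fin P) :=
  WithLp.toLp 2 fun p => E p c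

theorem inner_colVec (E : Matrix (Fin P) (Fin C) ℝ) (c d : Fin C) :
    inner ℝ (colVec E c) (colVec E d) = (Eᵀ * E) c d := by
  simp [PiLp.inner_apply, colVec, Matrix.mul_apply, mul_comm]

theorem inner_colVec_left (E : Matrix (Fin P) (Fin C) ℝ) (c : Fin C)
    (h : EuclideanSpace ℝ (Fin P)) : inner ℝ (colVec E c) h = (Eᵀ *ᵥ h.ofLp) c := by
  simp [PiLp.inner_apply, colVec, Matrix.mulVec, dotProduct, mul_comm]

theorem continuous_colVec (c : Fin C) :
    Continuous fun E : Matrix (Fin P) (Fin C) ℝ => colVec E c := by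
  refine (PiLp.continuous_toLp 2 _).comp ?_
  fun_prop

/-- A positive scale disappears on normalization, so directions converge as soon as some rescaling
has a nonzero limit. -/
theorem tendsto_inv_norm_smul {E : Type*} [NormedAddCommGroup E] [NormedSpace ℝ E] {w : ℝ → E}
    {e : E} {s : ℝ → ℝ} (hs : ∀ᶠ t in atTop, 0 < s t) (he : e ≠ 0)
    (h : Tendsto (fun t => s t • w t) atTop (𝓝 e)) :
    Tendsto (fun t => ‖w t‖⁻¹ • w t) atTop (𝓝 (‖e‖⁻¹ • e)) := by
  have h1 := (h.norm.inv₀ (norm_ne_zero_iff.2 he)).smul h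
  refine h1.congr' (hs.mono fun t ht => ?_)
  rw [norm_smul, Real.norm_of_nonneg ht.le, smul_smul, mul_inv, mul_right_comm,
    inv_mul_cancel₀ ht.ne', one_mul]

namespace IsCollapsing

variable {X : ℝ → Features P C N} {U : Matrix (Fin P) (Fin (C - 1)) ℝ}
  {ω : ℝ → Fin (C - 1) → ℝ} {V : Matrix (Fin C) (Fin (C - 1)) ℝ} {ρ : ℝ → ℝ}

theorem class_ne_zero (h : IsCollapsing X U ω V ρ) : C ≠ 0 := by
  have := h.two_le
  omega

theorem mul_transpose (h : IsCollapsing X U ω V ρ) : V * Vᵀ = centeringProj C :=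
  mul_transpose_eq_centeringProj h.two_le (h.svd 0 le_rfl).right_orthonormal
    ((h.svd 0 le_rfl).sum_right (sum_centeredMeans h.class_ne_zero _))

theorem gram (h : IsCollapsing X U ω V ρ) : (U * Vᵀ)ᵀ * (U * Vᵀ) = centeringProj C := by
  rw [Matrix.transpose_mul, Matrix.transpose_transpose, Matrix.mul_assoc, ← Matrix.mul_assoc Uᵀ,
    (h.svd 0 le_rfl).left_orthonormal, Matrix.one_mul, h.mul_transpose]

theorem isSimplexETF (h : IsCollapsing X U ω V ρ) : IsSimplexETF (U * Vᵀ) := by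
  have h2 : (2 : ℝ) ≤ C := by exact_mod_cast h.two_le
  have h0 : (C : ℝ) ≠ 0 := by linarith
  have h1 : (C : ℝ) - 1 ≠ 0 := by linarith
  refine ⟨((C : ℝ) - 1) / C, div_pos (by linarith) (by linarith), ?_⟩
  rw [h.gram, centeringProj, smul_sub, smul_smul, smul_smul]
  congr 1
  · rw [div_mul_div_cancel₀ h0, div_self h1, one_smul]
  · congr 1
    field_simp

theorem scale_pos (h : IsCollapsing X U ω V ρ) {t : ℝ} (ht : 0 ≤ t) : 0 < ρ t := by
  obtain ⟨j, hj⟩ := h.scale t ht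
  rw [hj]
  exact (h.svd t ht).pos j

theorem eventually_scale_pos (h : IsCollapsing X U ω V ρ) : ∀ᶠ t in atTop, 0 < ρ t :=
  (eventually_ge_atTop 0).mono fun _ => h.scale_pos

/-- The index realizing `ρ t` may change with time, so all singular values are made large
simultaneously. -/
theorem tendsto_scale (h : IsCollapsing X U ω V ρ) : Tendsto ρ atTop atTop := by
  rw [tendsto_atTop]
  intro b
  have h1 : ∀ᶠ t in atTop, ∀ j, b ≤ ω t j :=
    eventually_all.2 fun j => (tendsto_atTop.1 (h.tendsto j)) b
  filter_upwards [h1, eventually_ge_atTop 0] with t ht ht0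
  obtain ⟨j, hj⟩ := h.scale t ht0
  exact hj ▸ ht j

theorem tendsto_inv_scale (h : IsCollapsing X U ω V ρ) :
    Tendsto (fun t => (ρ t)⁻¹) atTop (𝓝 0) :=
  tendsto_inv_atTop_zero.comp h.tendsto_scale

theorem exists_bound (h : IsCollapsing X U ω V ρ) :
    ∃ B, ∀ t, 0 ≤ t → ∀ j, |ω t j ^ 2 - ρ t ^ 2| ≤ B := by
  choose B hB using h.bounded
  refine ⟨∑ i, ∑ j, |B i j|, fun t ht j => ?_⟩
  obtain ⟨i, hi⟩ := h.scale t ht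
  rw [hi]
  refine ((hB j i t).trans (le_abs_self _)).trans ?_
  refine (Finset.single_le_sum (f := fun i => |B j i|) (fun _ _ => abs_nonneg _)
    (Finset.mem_univ i)).trans ?_
  exact Finset.single_le_sum (f := fun j => ∑ i, |B j i|)
    (fun _ _ => Finset.sum_nonneg fun _ _ => abs_nonneg _) (Finset.mem_univ j)

/-- The squared ratio differs from 1 by a bounded quantity over `ρ²`. -/
theorem tendsto_ratio (h : IsCollapsing X U ω V ρ) (j : Fin (C - 1)) :
    Tendsto (fun t => ω t j / ρ t) atTop (𝓝 1) := by
  obtain ⟨B, hB⟩ := h.exists_bound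
  have h1 : Tendsto (fun t => (ω t j / ρ t) ^ 2 - 1) atTop (𝓝 0) := by
    have h2 : Tendsto (fun t => B * ((ρ t)⁻¹ * (ρ t)⁻¹)) atTop (𝓝 0) := by
      simpa using (h.tendsto_inv_scale.mul h.tendsto_inv_scale).const_mul B
    refine squeeze_zero_norm' ?_ h2
    filter_upwards [eventually_ge_atTop 0] with t ht
    have hρ := h.scale_pos ht
    have e : (ω t j / ρ t) ^ 2 - 1 = (ω t j ^ 2 - ρ t ^ 2) * ((ρ t)⁻¹ * (ρ t)⁻¹) := by
      field_simp
    rw [e, norm_mul, Real.norm_eq_abs, Real.norm_of_nonneg (by positivity)]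
    exact mul_le_mul_of_nonneg_right (hB t ht j) (by positivity)
  have h3 := (h1.add_const 1).sqrt
  rw [zero_add, Real.sqrt_one] at h3
  refine h3.congr' ?_
  filter_upwards [eventually_ge_atTop 0] with t ht
  rw [sub_add_cancel, Real.sqrt_sq (div_nonneg ((h.svd t ht).pos j).le (h.scale_pos ht).le)]

theorem tendsto_mul_diagonal_mul {r : ℕ} {d : ℝ → Fin r → ℝ} {a : Fin r → ℝ}
    (hd : ∀ j, Tendsto (fun t => d t j) atTop (𝓝 (a j))) {m n : ℕ} (A : Matrix (Fin m) (Fin r) ℝ)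
    (B : Matrix (Fin r) (Fin n) ℝ) :
    Tendsto (fun t => A * diagonal (d t) * B) atTop (𝓝 (A * diagonal a * B)) := by
  have hc : Continuous fun d : Fin r → ℝ => A * diagonal d * B := by fun_prop
  exact (hc.tendsto a).comp (tendsto_pi_nhds.2 hd)

theorem tendsto_means (h : IsCollapsing X U ω V ρ) :
    Tendsto (fun t => (ρ t)⁻¹ • centeredMeans (X t)) atTop (𝓝 (U * Vᵀ)) := by
  have h1 := tendsto_mul_diagonal_mul h.tendsto_ratio U Vᵀ
  rw [show (diagonal fun _ : Fin (C - 1) => (1 : ℝ)) = 1 from Matrix.diagonal_one,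
    Matrix.mul_one] at h1
  refine h1.congr' ?_
  filter_upwards [eventually_ge_atTop 0] with t ht
  rw [(h.svd t ht).eq, ← Matrix.smul_mul, ← Matrix.mul_smul, ← Matrix.diagonal_smul]
  congr 3
  ext j
  simp [div_eq_inv_mul]

/-- The transposed weights are `R M / C`, with the singular vectors of `M` and singular values `ω /
(C + ω²)`, asymptotic to `1 / ω`. -/
theorem tendsto_weights (h : IsCollapsing X U ω V ρ) :
    Tendsto (fun t => ρ t • (weightLS (X t))ᵀ) atTop (𝓝 (U * Vᵀ)) := by
  have hC : (C : ℝ) ≠ 0 := by exact_mod_cast h.class_ne_zero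
  have h0 : ∀ j, Tendsto (fun t => ρ t * (1 / (C : ℝ) * ((1 + ω t j ^ 2 / C)⁻¹ * ω t j))) atTop
      (𝓝 1) := by
    intro j
    have hi : Tendsto (fun t => (ω t j)⁻¹) atTop (𝓝 0) :=
      tendsto_inv_atTop_zero.comp (h.tendsto j)
    have h1 : Tendsto (fun t => (ω t j / ρ t)⁻¹ * ((C : ℝ) * ((ω t j)⁻¹ * (ω t j)⁻¹) + 1)⁻¹)
        atTop (𝓝 (1⁻¹ * ((C : ℝ) * (0 * 0) + 1)⁻¹)) :=
      ((h.tendsto_ratio j).inv₀ one_ne_zero).mul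
        ((((hi.mul hi).const_mul (C : ℝ)).add_const 1).inv₀ (by simp))
    simp only [mul_zero, zero_add, inv_one, mul_one] at h1
    refine h1.congr' ?_
    filter_upwards [eventually_ge_atTop 0] with t ht
    have hω := (h.svd t ht).pos j
    have hρ := h.scale_pos ht
    have hc : 0 < (C : ℝ) := lt_of_le_of_ne (Nat.cast_nonneg C) hC.symm
    field_simp
  have h1 := tendsto_mul_diagonal_mul h0 U Vᵀ
  rw [show (diagonal fun _ : Fin (C - 1) => (1 : ℝ)) = 1 from Matrix.diagonal_one,
    Matrix.mul_one] at h1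
  refine h1.congr' ?_
  filter_upwards [eventually_ge_atTop 0] with t ht
  have h2 : (weightLS (X t))ᵀ = (1 / (C : ℝ)) • (resolvent (centeredMeans (X t)) ^ 1 *
      centeredMeans (X t)) := by
    rw [weightLS, Matrix.transpose_smul, Matrix.transpose_mul, Matrix.transpose_transpose,
      Matrix.transpose_nonsing_inv, totalCov_transpose,
      totalCov_eq_one_add h.class_ne_zero h.ne_zero (h.mem t ht), pow_one, resolvent]
  rw [h2, (h.svd t ht).eq, resolvent_pow_mul_svd (h.svd t ht).left_orthonormal
    (h.svd t ht).right_orthonormal, smul_smul, ← Matrix.smul_mul, ← Matrix.mul_smul,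
    ← Matrix.diagonal_smul]
  congr 3
  ext j
  simp [mul_assoc]

/-- Identity within-class covariance bounds every deviation from a class mean by `√(C N)`, which is
negligible against `ρ`. -/
theorem tendsto_centered (h : IsCollapsing X U ω V ρ) :
    Tendsto (fun t => (ρ t)⁻¹ • centered (X t)) atTop (𝓝 (kronOnes N (U * Vᵀ))) := by
  have hCN : (0 : ℝ) < C * N := by
    have h1 : 0 < C := Nat.pos_of_ne_zero h.class_ne_zero
    have h2 : 0 < N := Nat.pos_of_ne_zero h.ne_zero
    positivity
  refine tendsto_pi_nhds.2 fun p => tendsto_pi_nhds.2 fun k => ?_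
  have h1 : Tendsto (fun t => ((ρ t)⁻¹ • centeredMeans (X t)) p k.1) atTop
      (𝓝 ((U * Vᵀ) p k.1)) := tendsto_pi_nhds.1 (tendsto_pi_nhds.1 h.tendsto_means p) k.1
  have h2 : Tendsto (fun t => (ρ t)⁻¹ * (X t p k - classMean (X t) k.1 p)) atTop (𝓝 0) := by
    refine squeeze_zero_norm' (a := fun t => (ρ t)⁻¹ * √((C : ℝ) * N)) ?_
      (by simpa using h.tendsto_inv_scale.mul_const (√((C : ℝ) * N)))
    filter_upwards [eventually_ge_atTop 0] with t ht
    have hW : withinCov (X t) p p = 1 := by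
      rw [show withinCov (X t) = 1 from h.mem t ht, Matrix.one_apply_eq]
    rw [norm_mul, Real.norm_of_nonneg (inv_nonneg.2 (h.scale_pos ht).le)]
    refine mul_le_mul_of_nonneg_left ?_ (inv_nonneg.2 (h.scale_pos ht).le)
    refine Real.abs_le_sqrt ?_
    have hW2 : ∑ k : Fin C × Fin N, (X t p k - classMean (X t) k.1 p) ^ 2 = (C : ℝ) * N := by
      have : (1 / ((C : ℝ) * N)) * ∑ k : Fin C × Fin N, (X t p k - classMean (X t) k.1 p) ^ 2 = 1 := by
        refine Eq.trans ?_ hW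
        simp [withinCov, Matrix.sum_apply, vecMulVec_apply, sq]
      rw [one_div, inv_mul_eq_iff_eq_mul₀ hCN.ne', mul_one] at this
      exact this
    rw [← hW2]
    exact Finset.single_le_sum (f := fun k => (X t p k - classMean (X t) k.1 p) ^ 2)
      (fun _ _ => sq_nonneg _) (Finset.mem_univ k)
  have h3 := h1.add h2
  rw [add_zero] at h3
  have h4 : kronOnes N (U * Vᵀ) p k = (U * Vᵀ) p k.1 := by
    simp [kronOnes, onesRow, Matrix.kroneckerMap_apply]
  rw [h4]
  refine h3.congr fun t => ?_
  simp only [Matrix.smul_apply, centeredMeans, centered, Matrix.of_apply, smul_eq_mul]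
  ring

/-! ### Limits of individual means, weights and features, and the sharper estimate of the norms. -/

theorem tendsto_centeredMeanVec (h : IsCollapsing X U ω V ρ) (c : Fin C) :
    Tendsto (fun t => (ρ t)⁻¹ • centeredMeanVec (X t) c) atTop (𝓝 (colVec (U * Vᵀ) c)) :=
  ((continuous_colVec c).tendsto _).comp h.tendsto_means

theorem tendsto_weightVec (h : IsCollapsing X U ω V ρ) (c : Fin C) :
    Tendsto (fun t => ρ t • weightVec (X t) c) atTop (𝓝 (colVec (U * Vᵀ) c)) :=
  ((continuous_colVec c).tendsto _).comp h.tendsto_weights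

theorem tendsto_featureVec (h : IsCollapsing X U ω V ρ) (c : Fin C) (i : Fin N) :
    Tendsto (fun t => (ρ t)⁻¹ • featureVec (X t) c i) atTop (𝓝 (colVec (U * Vᵀ) c)) := by
  have h1 : Tendsto (fun t => (fun p => (ρ t)⁻¹ * centered (X t) p (c, i))) atTop
      (𝓝 fun p => (U * Vᵀ) p c) := by
    refine tendsto_pi_nhds.2 fun p => ?_
    have := tendsto_pi_nhds.1 (tendsto_pi_nhds.1 h.tendsto_centered p) (c, i)
    simpa [kronOnes, onesRow, Matrix.kroneckerMap_apply] using this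
  refine (((PiLp.continuous_toLp 2 _).tendsto _).comp h1).congr' ?_
  filter_upwards [eventually_ge_atTop 0] with t ht
  ext p
  simp [featureVec, centered, h.mean t ht]

theorem inner_colVec_eq (h : IsCollapsing X U ω V ρ) (c d : Fin C) :
    inner ℝ (colVec (U * Vᵀ) c) (colVec (U * Vᵀ) d) = (if c = d then 1 else 0) - 1 / (C : ℝ) := by
  rw [inner_colVec, h.gram, centeringProj_apply]

theorem norm_colVec_sq (h : IsCollapsing X U ω V ρ) (c : Fin C) :
    ‖colVec (U * Vᵀ) c‖ ^ 2 = 1 - 1 / (C : ℝ) := by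
  rw [← real_inner_self_eq_norm_sq, h.inner_colVec_eq, if_pos rfl]

theorem one_sub_pos (h : IsCollapsing X U ω V ρ) : 0 < 1 - 1 / (C : ℝ) := by
  have h2 : (2 : ℝ) ≤ C := by exact_mod_cast h.two_le
  rw [sub_pos, div_lt_one (by linarith)]
  linarith

theorem colVec_ne_zero (h : IsCollapsing X U ω V ρ) (c : Fin C) : colVec (U * Vᵀ) c ≠ 0 := by
  intro h0
  have := h.norm_colVec_sq c
  rw [h0, norm_zero] at this
  have := h.one_sub_pos
  norm_num at *
  linarith

theorem colVec_ne (h : IsCollapsing X U ω V ρ) {c d : Fin C} (hcd : c ≠ d) :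
    colVec (U * Vᵀ) c ≠ colVec (U * Vᵀ) d := by
  intro h0
  have h1 := h.inner_colVec_eq c d
  rw [← h0, h.inner_colVec_eq, if_pos rfl, if_neg hcd] at h1
  norm_num at h1

/-- `‖μ_c - μ_G‖²` is the sum of `V_cj² ω_j²`, whose weights add up to `1 - 1 / C`, the diagonal
entry of `V Vᵀ`; each `ω_j²` is within a bounded distance of `ρ²`. -/
theorem norm_sq_centeredMeanVec_bound (h : IsCollapsing X U ω V ρ) :
    ∃ B, ∀ t, 0 ≤ t → ∀ c,
      |‖centeredMeanVec (X t) c‖ ^ 2 - (1 - 1 / (C : ℝ)) * ρ t ^ 2| ≤ B := by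
  obtain ⟨B, hB⟩ := h.exists_bound
  refine ⟨(1 - 1 / (C : ℝ)) * B, fun t ht c => ?_⟩
  have hV : ∑ j, V c j ^ 2 = 1 - 1 / (C : ℝ) := by
    have h1 := congrFun (congrFun h.mul_transpose c) c
    rw [centeringProj_apply, if_pos rfl] at h1
    rw [← h1]
    simp [Matrix.mul_apply, sq]
  have hM : ‖centeredMeanVec (X t) c‖ ^ 2 = ∑ j, V c j ^ 2 * ω t j ^ 2 := by
    have h1 := congrFun (congrFun (h.svd t ht).transpose_mul_self c) c
    rw [show centeredMeanVec (X t) c = colVec (centeredMeans (X t)) c from rfl,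
      ← real_inner_self_eq_norm_sq, inner_colVec, h1, Matrix.mul_apply]
    refine Finset.sum_congr rfl fun j _ => ?_
    rw [Matrix.mul_diagonal, Matrix.transpose_apply]
    ring
  rw [hM, ← hV, Finset.sum_mul, ← Finset.sum_sub_distrib, Finset.sum_mul]
  refine (Finset.abs_sum_le_sum_abs _ _).trans (Finset.sum_le_sum fun j _ => ?_)
  rw [← mul_sub, abs_mul, abs_of_nonneg (sq_nonneg _)]
  exact mul_le_mul_of_nonneg_left (hB t ht j) (sq_nonneg _)

/-- Convergence of the rescaled means alone would only make the defect small against `ρ²`; here it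
is small against `ρ`. -/
theorem tendsto_norm_sq_defect (h : IsCollapsing X U ω V ρ) (c : Fin C) :
    Tendsto (fun t => (ρ t)⁻¹ *
      (‖centeredMeanVec (X t) c‖ ^ 2 - (1 - 1 / (C : ℝ)) * ρ t ^ 2)) atTop (𝓝 0) := by
  obtain ⟨B, hB⟩ := h.norm_sq_centeredMeanVec_bound
  refine squeeze_zero_norm' (a := fun t => (ρ t)⁻¹ * B) ?_
    (by simpa using h.tendsto_inv_scale.mul_const B)
  filter_upwards [eventually_ge_atTop 0] with t ht
  rw [norm_mul, Real.norm_of_nonneg (inv_nonneg.2 (h.scale_pos ht).le)]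
  exact mul_le_mul_of_nonneg_left (hB t ht c) (inv_nonneg.2 (h.scale_pos ht).le)

/-! ### Neural collapse -/

theorem nc1 (h : IsCollapsing X U ω V ρ) : NC1 X := by
  have hC : (1 / (C : ℝ)) ≠ 0 := one_div_ne_zero (by exact_mod_cast h.class_ne_zero)
  have h0 : ∀ j, Tendsto (fun t => (1 / (C : ℝ) * ω t j ^ 2)⁻¹) atTop (𝓝 0) := by
    intro j
    have hi : Tendsto (fun t => (ω t j)⁻¹) atTop (𝓝 0) :=
      tendsto_inv_atTop_zero.comp (h.tendsto j)
    have := ((hi.mul hi).const_mul (1 / (C : ℝ))⁻¹)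
    simp only [mul_zero] at this
    refine this.congr fun t => ?_
    rw [mul_inv, sq, mul_inv]
  have h1 := tendsto_mul_diagonal_mul h0 U Uᵀ
  rw [show (diagonal fun _ : Fin (C - 1) => (0 : ℝ)) = 0 from Matrix.diagonal_zero,
    Matrix.mul_zero, Matrix.zero_mul] at h1
  refine h1.congr' ?_
  filter_upwards [eventually_ge_atTop 0] with t ht
  rw [show withinCov (X t) = 1 from h.mem t ht, Matrix.mul_one, betweenCov_eq,
    (h.svd t ht).pinv_smul_mul_transpose hC]

theorem nc2 (h : IsCollapsing X U ω V ρ) : NC2 X := by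
  have h2 : (2 : ℝ) ≤ C := by exact_mod_cast h.two_le
  have h1 := h.one_sub_pos
  have hn : ∀ c, ‖colVec (U * Vᵀ) c‖ ≠ 0 := fun c => norm_ne_zero_iff.2 (h.colVec_ne_zero c)
  have hnn : ∀ c d, ‖colVec (U * Vᵀ) c‖ = ‖colVec (U * Vᵀ) d‖ := fun c d => by
    rw [← sq_eq_sq₀ (norm_nonneg _) (norm_nonneg _), h.norm_colVec_sq, h.norm_colVec_sq]
  refine ⟨fun c d => ?_, fun c d _ => ?_⟩
  · have h3 := ((h.tendsto_centeredMeanVec c).inner (𝕜 := ℝ) (h.tendsto_centeredMeanVec d)).div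
      ((h.tendsto_centeredMeanVec c).norm.mul (h.tendsto_centeredMeanVec d).norm)
      (mul_ne_zero (hn c) (hn d))
    have h4 : inner ℝ (colVec (U * Vᵀ) c) (colVec (U * Vᵀ) d) /
        (‖colVec (U * Vᵀ) c‖ * ‖colVec (U * Vᵀ) d‖) =
        if c = d then 1 else -1 / ((C : ℝ) - 1) := by
      rw [hnn d c, ← sq, h.norm_colVec_sq, h.inner_colVec_eq]
      split_ifs
      · exact div_self h1.ne'
      · have : (C : ℝ) - 1 ≠ 0 := by linarith
        have : (C : ℝ) ≠ 0 := by linarith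
        field_simp
        ring
    rw [h4] at h3
    refine h3.congr' ?_
    filter_upwards [eventually_ge_atTop 0] with t ht
    have hρ := inv_pos.2 (h.scale_pos ht)
    rw [Pi.div_apply, real_inner_smul_left, real_inner_smul_right, norm_smul, norm_smul,
      Real.norm_of_nonneg hρ.le, ← mul_assoc, mul_mul_mul_comm,
      mul_div_mul_left _ _ (mul_pos hρ hρ).ne']
  -- A difference of norms is the difference of squares over the sum; both are divided by `ρ`, and
  -- the sum keeps a positive limit.
  · have h3 := ((h.tendsto_norm_sq_defect c).sub (h.tendsto_norm_sq_defect d)).div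
      ((h.tendsto_centeredMeanVec c).norm.add (h.tendsto_centeredMeanVec d).norm)
      (add_pos_of_pos_of_nonneg (lt_of_le_of_ne (norm_nonneg _) (hn c).symm)
        (norm_nonneg _)).ne'
    rw [sub_zero, zero_div] at h3
    refine h3.congr' ?_
    have hpos : ∀ᶠ t in atTop, 0 < ‖(ρ t)⁻¹ • centeredMeanVec (X t) c‖ :=
      (h.tendsto_centeredMeanVec c).norm.eventually_const_lt
        (lt_of_le_of_ne (norm_nonneg _) (hn c).symm)
    filter_upwards [eventually_ge_atTop 0, hpos] with t ht hp
    have hρ := inv_pos.2 (h.scale_pos ht)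
    rw [norm_smul, Real.norm_of_nonneg hρ.le] at hp
    have hm : 0 < ‖centeredMeanVec (X t) c‖ := pos_of_mul_pos_right hp hρ.le
    have hs : 0 < ‖centeredMeanVec (X t) c‖ + ‖centeredMeanVec (X t) d‖ :=
      add_pos_of_pos_of_nonneg hm (norm_nonneg _)
    simp only [Pi.div_apply]
    rw [norm_smul, norm_smul, Real.norm_of_nonneg hρ.le, ← mul_sub, ← mul_add,
      mul_div_mul_left _ _ hρ.ne', div_eq_iff hs.ne']
    ring

theorem nc3 (h : IsCollapsing X U ω V ρ) : NC3 X := by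
  intro c
  have h1 := tendsto_inv_norm_smul h.eventually_scale_pos (h.colVec_ne_zero c)
    (h.tendsto_weightVec c)
  have h2 := tendsto_inv_norm_smul (h.eventually_scale_pos.mono fun t => inv_pos.2)
    (h.colVec_ne_zero c) (h.tendsto_centeredMeanVec c)
  simpa using h1.sub h2

/-- Both rules, suitably rescaled, have scores converging to `⟨U Vᵀ e_d, x⟩`. For the nearest mean
the squared norms enter only through their defect over `ρ`, which vanishes. -/
theorem eventually_decisions_eq (h : IsCollapsing X U ω V ρ) {x : EuclideanSpace ℝ (Fin P)}
    {c : Fin C} (hx : ∀ d, d ≠ c → ((U * Vᵀ)ᵀ *ᵥ x.ofLp) d < ((U * Vᵀ)ᵀ *ᵥ x.ofLp) c) :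
    ∀ᶠ t in atTop, classifierDecision (X t) x = {c} ∧ nearestMeanDecision (X t) x = {c} := by
  have h1 : ∀ d, Tendsto (fun t => ((ρ t • (weightLS (X t))ᵀ)ᵀ *ᵥ ((1 : ℝ) • x.ofLp)) d) atTop
      (𝓝 (((U * Vᵀ)ᵀ *ᵥ x.ofLp) d)) := by
    intro d
    have hc : Continuous fun E : Matrix (Fin P) (Fin C) ℝ => (Eᵀ *ᵥ ((1 : ℝ) • x.ofLp)) d := by
      have : Continuous fun E : Matrix (Fin P) (Fin C) ℝ => Eᵀ *ᵥ ((1 : ℝ) • x.ofLp) := by fun_prop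
      exact (continuous_apply d).comp this
    have := (hc.tendsto _).comp h.tendsto_weights
    rw [one_smul] at this
    simpa only [one_smul, Function.comp_def] using this
  have h2 : ∀ d, Tendsto (fun t => inner ℝ ((ρ t)⁻¹ • centeredMeanVec (X t) d) x -
      (ρ t)⁻¹ * (‖centeredMeanVec (X t) d‖ ^ 2 - (1 - 1 / (C : ℝ)) * ρ t ^ 2) / 2) atTop
      (𝓝 (((U * Vᵀ)ᵀ *ᵥ x.ofLp) d)) := by
    intro d
    have := ((h.tendsto_centeredMeanVec d).inner (𝕜 := ℝ) (tendsto_const_nhds (x := x))).sub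
      ((h.tendsto_norm_sq_defect d).div_const 2)
    rwa [zero_div, sub_zero, inner_colVec_left] at this
  filter_upwards [eventually_argmax_eq h1 hx, eventually_argmax_eq h2 hx,
    eventually_ge_atTop 0] with t ht1 ht2 ht
  exact ⟨by rw [classifierDecision_eq (h.mean t ht) (h.scale_pos ht) one_pos, ht1],
    by rw [nearestMeanDecision_eq' (h.mean t ht) (inv_pos.2 (h.scale_pos ht)), ht2]⟩

/-- A training feature grows like `ρ` times its column of `U Vᵀ`. After rescaling, both rules
compare that column with all columns, by inner products or by distances, and it wins strictly. -/
theorem eventually_decisions_feature_eq (h : IsCollapsing X U ω V ρ) (c : Fin C) (i : Fin N) :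
    ∀ᶠ t in atTop, classifierDecision (X t) (featureVec (X t) c i) = {c} ∧
      nearestMeanDecision (X t) (featureVec (X t) c i) = {c} := by
  have h1 : ∀ d, Tendsto (fun t => ((ρ t • (weightLS (X t))ᵀ)ᵀ *ᵥ
      ((ρ t)⁻¹ • (featureVec (X t) c i).ofLp)) d) atTop
      (𝓝 (inner ℝ (colVec (U * Vᵀ) d) (colVec (U * Vᵀ) c))) := by
    intro d
    refine ((h.tendsto_weightVec d).inner (𝕜 := ℝ) (h.tendsto_featureVec c i)).congr fun t => ?_
    exact inner_colVec_left (ρ t • (weightLS (X t))ᵀ) d ((ρ t)⁻¹ • featureVec (X t) c i)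
  have h2 : ∀ d, Tendsto (fun t => -‖(ρ t)⁻¹ • featureVec (X t) c i -
      (ρ t)⁻¹ • centeredMeanVec (X t) d‖) atTop
      (𝓝 (-‖colVec (U * Vᵀ) c - colVec (U * Vᵀ) d‖)) := fun d =>
    ((h.tendsto_featureVec c i).sub (h.tendsto_centeredMeanVec d)).norm.neg
  have h3 : ∀ d, d ≠ c → inner ℝ (colVec (U * Vᵀ) d) (colVec (U * Vᵀ) c) <
      inner ℝ (colVec (U * Vᵀ) c) (colVec (U * Vᵀ) c) := by
    intro d hd
    rw [h.inner_colVec_eq, h.inner_colVec_eq, if_neg hd, if_pos rfl]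
    linarith
  have h4 : ∀ d, d ≠ c → -‖colVec (U * Vᵀ) c - colVec (U * Vᵀ) d‖ <
      -‖colVec (U * Vᵀ) c - colVec (U * Vᵀ) c‖ := by
    intro d hd
    rw [sub_self, norm_zero, neg_lt_neg_iff, norm_pos_iff, sub_ne_zero]
    exact h.colVec_ne hd.symm
  filter_upwards [eventually_argmax_eq h1 h3, eventually_argmax_eq h2 h4,
    eventually_ge_atTop 0] with t ht1 ht2 ht
  exact ⟨by rw [classifierDecision_eq (h.mean t ht) (h.scale_pos ht) (inv_pos.2 (h.scale_pos ht)),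
      ht1],
    by rw [nearestMeanDecision_eq (h.mean t ht) (inv_pos.2 (h.scale_pos ht)), ht2]⟩

/-- Distinct classes have distinct columns, so each tie set is a proper subspace, hence null. -/
theorem ae_no_tie (h : IsCollapsing X U ω V ρ) : ∀ᵐ x : EuclideanSpace ℝ (Fin P),
    ∀ c d : Fin C, c ≠ d → ((U * Vᵀ)ᵀ *ᵥ x.ofLp) c ≠ ((U * Vᵀ)ᵀ *ᵥ x.ofLp) d := by
  rw [ae_all_iff]
  intro c
  rw [ae_all_iff]
  intro d
  by_cases hcd : c = d
  · exact Eventually.of_forall fun x hne => absurd hcd hne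
  set v := colVec (U * Vᵀ) c - colVec (U * Vᵀ) d with hv
  have hv0 : v ≠ 0 := sub_ne_zero.2 (h.colVec_ne hcd)
  have hK : (LinearMap.ker (innerSL ℝ v : EuclideanSpace ℝ (Fin P) →L[ℝ] ℝ).toLinearMap) ≠ ⊤ := by
    intro htop
    have h1 : v ∈ LinearMap.ker (innerSL ℝ v : EuclideanSpace ℝ (Fin P) →L[ℝ] ℝ).toLinearMap := by
      rw [htop]; trivial
    rw [LinearMap.mem_ker] at h1
    exact hv0 (inner_self_eq_zero.1 h1)
  have hnull := Measure.addHaar_submodule (volume : Measure (EuclideanSpace ℝ (Fin P))) _ hK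
  have hae := measure_eq_zero_iff_ae_notMem.1 hnull
  filter_upwards [hae] with x hx _ heq
  apply hx
  rw [SetLike.mem_coe, LinearMap.mem_ker]
  change inner ℝ v x = 0
  rw [hv, inner_sub_left, inner_colVec_left, inner_colVec_left, heq, sub_self]

theorem nc4 (h : IsCollapsing X U ω V ρ) : NC4 X := by
  refine ⟨?_, h.eventually_decisions_feature_eq⟩
  filter_upwards [h.ae_no_tie] with x hx
  have : Nonempty (Fin C) := ⟨⟨0, Nat.pos_of_ne_zero h.class_ne_zero⟩⟩
  obtain ⟨c, hc⟩ := Finite.exists_max fun c => ((U * Vᵀ)ᵀ *ᵥ x.ofLp) c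
  exact (h.eventually_decisions_eq fun d hd => (hc d).lt_of_ne (hx d c hd)).mono
    fun t ht => ht.1.trans ht.2.symm

end IsCollapsing

/-! ### Renormalized features -/

theorem centeredMeans_renormalize (H : Features P C N) :
    centeredMeans (renormalize H) = snr H := by
  rw [centeredMeans_eq, renormalize, snr, centeredMeans_eq, Matrix.mul_assoc]

theorem globalMean_mul (A : Matrix (Fin P) (Fin P) ℝ) (H : Features P C N) :
    globalMean (A * H) = A *ᵥ globalMean H := by
  ext p
  simp only [globalMean, Matrix.mul_apply, Matrix.mulVec, dotProduct, Finset.mul_sum]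
  rw [Finset.sum_comm]
  exact Finset.sum_congr rfl fun q _ => Finset.sum_congr rfl fun k _ => by ring

theorem centered_renormalize (H : Features P C N) :
    centered (renormalize H) = invSqrt (withinCov H) * centered H := by
  ext p k
  simp only [centered, Matrix.of_apply, renormalize, globalMean_mul, Matrix.mul_apply,
    Matrix.mulVec, dotProduct, mul_sub, Finset.sum_sub_distrib]

/-- Without examples the within-class covariance is zero, which differs from the identity in
positive dimension. -/
theorem examples_ne_zero {X : Features P C N} (hX : X ∈ manifold P C N) (hP : P ≠ 0) : N ≠ 0 := by
  rintro rfl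
  have h1 : withinCov X = 1 := hX
  have h2 := congrFun (congrFun h1 ⟨0, Nat.pos_of_ne_zero hP⟩) ⟨0, Nat.pos_of_ne_zero hP⟩
  simp [withinCov] at h2

theorem isCollapsing_renormalize (hC : 2 ≤ C) {H : ℝ → Features P C N}
    (hmean : globalMean (H 0) = 0) (hrank : (snr (H 0)).rank = C - 1)
    (hflow : IsRenormalizedFlow fun t => renormalize (H t)) {U : Matrix (Fin P) (Fin (C - 1)) ℝ}
    {ω₀ : Fin (C - 1) → ℝ} {V : Matrix (Fin C) (Fin (C - 1)) ℝ}
    (hsvd : IsCompactSVD (snr (H 0)) U ω₀ V) :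
    ∃ ω, IsCollapsing (fun t => renormalize (H t)) U ω V
      fun t => maxSingularValue (snr (H t)) := by
  have hC0 : C ≠ 0 := by omega
  -- The rank `C - 1` is at least 1 and at most `P`.
  have hP : P ≠ 0 := by
    have := (snr (H 0)).rank_le_height
    omega
  have hmem : ∀ t, 0 ≤ t → renormalize (H t) ∈ manifold P C N := by
    rcases hflow with h | h
    · exact fun t ht => (h t ht).1
    · exact fun t ht => (h t ht).1
  have hN := examples_ne_zero (hmem 0 le_rfl) hP
  have hmean' : globalMean (renormalize (H 0)) = 0 := by
    rw [renormalize, globalMean_mul, hmean, Matrix.mulVec_zero]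
  obtain ⟨⟨k, hk, hM⟩, hg⟩ := flow_means hC0 hN hflow hmean'
  have hκ : 0 < 1 / ((C : ℝ) ^ 2 * N) := by
    have h1 : 0 < C := Nat.pos_of_ne_zero hC0
    have h2 : 0 < N := Nat.pos_of_ne_zero hN
    positivity
  rw [← centeredMeans_renormalize] at hsvd
  obtain ⟨ω, hω, hlim, hbdd⟩ := means_flow_svd hC0 hκ hk hM hsvd
  refine ⟨ω, hC, hN, hmem, hg, hω, hlim, fun t ht => ?_, hbdd⟩
  have h1 := hω t ht
  rw [centeredMeans_renormalize] at h1
  exact h1.exists_maxSingularValue_eq ⟨0, by omega⟩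

end NeuralCollapse

end

theorem corollary2 {P C N : ℕ} (hC : 2 ≤ C)
    (H : ℝ → Features P C N)
    (hpos : ∀ t : ℝ, 0 ≤ t → (withinCov (H t)).PosDef)
    (hmean : globalMean (H 0) = 0)
    (hrank : (snr (H 0)).rank = C - 1)
    (hflow : IsRenormalizedFlow fun t => renormalize (H t)) :
    (∀ (U : Matrix (Fin P) (Fin (C - 1)) ℝ) (ω : Fin (C - 1) → ℝ)
        (V : Matrix (Fin C) (Fin (C - 1)) ℝ), IsCompactSVD (snr (H 0)) U ω V →
      Tendsto (fun t => (1 / maxSingularValue (snr (H t))) • snr (H t)) atTop (𝓝 (U * Vᵀ)) ∧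
      IsSimplexETF (U * Vᵀ) ∧
      Tendsto (fun t => (1 / maxSingularValue (snr (H t))) •
        (invSqrt (withinCov (H t)) * centered (H t))) atTop (𝓝 (kronOnes N (U * Vᵀ))) ∧
      ∀ (h : EuclideanSpace ℝ (Fin P)) (c : Fin C),
        (∀ c', c' ≠ c → ((U * Vᵀ)ᵀ *ᵥ h.ofLp) c' < ((U * Vᵀ)ᵀ *ᵥ h.ofLp) c) →
        ∀ᶠ t in atTop, classifierDecision (renormalize (H t)) h = {c} ∧
          nearestMeanDecision (renormalize (H t)) h = {c}) ∧
    NC1 (fun t => renormalize (H t)) ∧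
    NC2 (fun t => renormalize (H t)) ∧
    NC3 (fun t => renormalize (H t)) ∧
    NC4 (fun t => renormalize (H t)) := by
  refine ⟨fun U ω V hsvd => ?_, ?_⟩
  · obtain ⟨ω', h⟩ := isCollapsing_renormalize hC hmean hrank hflow hsvd
    have h1 := h.tendsto_means
    have h2 := h.tendsto_centered
    simp only [centeredMeans_renormalize, centered_renormalize, ← one_div] at h1 h2
    exact ⟨h1, h.isSimplexETF, h2, fun x c hx => h.eventually_decisions_eq hx⟩
  -- NC1–NC4 do not refer to a decomposition, so any one may be chosen.
  · have hex := exists_isCompactSVD (snr (H 0))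
    rw [hrank] at hex
    obtain ⟨U, ω, V, hsvd⟩ := hex
    obtain ⟨ω', h⟩ := isCollapsing_renormalize hC hmean hrank hflow hsvd
    exact ⟨h.nc1, h.nc2, h.nc3, h.nc4⟩
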